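/- Let $\Lambda=(\mathbb Z/L)^3$ be the periodic cubic lattice with the $\ell_\infty$-metric. Consider a stabilizer code with finitely many qubits located at sites of $\Lambda$ and finitely many pairwise commuting Pauli generators located at elementary cubes, each acting only on qubits at the vertices of its cube; let $\mathcal G$ be the group they generate (Pauli operators are taken up to phase). A cube of linear size $\ell$ is a set of sites $a+\{0,\dots,\lfloor \ell\rfloor\}^3$. The syndrome $S(P)$ is the set of generators (defects) anticommuting with $P$; a set of defects is called a cluster; distances between defects are distances between the centers of their cubes; $d(C)$ is the diameter of a cluster $C$ (and $d(B)$ the linear size, i.e. the largest side, of a box $B$), and $b(C)$ is a minimal rectangular box (with vertices at centers of cubes) enclosing $C$. Let $L_{tqo}\le L/2$ be real and let $\alpha\ge 1$. Assume: (Topological order at scale $L_{tqo}$.) For every Pauli operator $P$ supported on a cube of linear size $L_{tqo}$: if $S(P)=\emptyset$ then $P\in\mathcal G$; if $S(P)\neq\emptyset$ then there is $G\in\mathcal G$ such that $PG$ is supported on the $1$-neighborhood of $b(S(P))$. (No-strings rule with constant $\alpha$.) Call a cluster neutral if it is $S(P)$ for some $P$ supported on a cube of linear size $L_{tqo}$.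 Whenever $P$ is supported on such a cube, $S(P)=C_1\sqcup C_2$, $d(C_1),d(C_2)\le r$ and $d(C_1,C_2)\ge\beta r$ for some $r\ge1$ and $\beta>\alpha$, both $C_1$ and $C_2$ are neutral. The energy barrier $\Delta(P)$ is the minimum, over all finite sequences $I=P_0,P_1,\dots,P_t=P$ of Pauli operators in which consecutive ones differ on at most one qubit, of $\max_i|S(P_i)|$. The RG decoder, given a syndrome $S$, sets $P_{ec}=I$ and, for each integer $p=0,1,2,\dots$ with $2^p<\min(L/2,L_{tqo})$ in turn, lets $Q$ be the product of $\mathrm{TestNeutral}(C)$ over all $2^p$-connected components $C$ of $S$ and updates $P_{ec}\leftarrow P_{ec}Q$, $S\leftarrow S\oplus S(Q)$; at the end it returns $P_{ec}$ if $S=\emptyset$ and fails otherwise. Here $\mathrm{TestNeutral}(C)$ returns a (fixed, arbitrarily chosen) Pauli operator with syndrome $C$ supported on the $1$-neighborhood of $b(C)$ if $d(b(C))\le L_{tqo}$ and such an operator exists, and returns $I$ otherwise. Then, for every implementation of TestNeutral: 1. If a Pauli error $P$ has energy barrier $m=\Delta(P)$ with $(80\alpha)^m<L_{tqo}$, then the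 RG decoder called on $S(P)$ does not fail and returns an operator $P_{ec}$ such that $P\cdot P_{ec}\in\mathcal G$. 2. Consequently, if $\gamma>0$ is such that $L_{tqo}\ge L^\gamma$, the RG decoder corrects (in the same sense) every Pauli error $P$ with $\Delta(P)<\frac{\gamma}{\log(80\alpha)}\log L$. -/

import Mathlib

/-- Sites of the 3D cubic lattice of linear size `L` with periodic boundary conditions. -/
abbrev Site (L : ℕ) := Fin 3 → ZMod L

/-- Elementary cubes, labelled by their lowest vertex: the cube `c` has its centre at
`c + (1/2, 1/2, 1/2)` and its vertices at `c + {0, 1}³`. -/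
abbrev Cube (L : ℕ) := Fin 3 → ZMod L

/-- Pauli operators on the qubits `Q`, i.e. tensor products of `I, X, Y, Z`, up to overall phase.
The pair `(x, z)` at a qubit stands for `X ^ x * Z ^ z`, so that `I = (0, 0)`, `X = (1, 0)`,
`Z = (0, 1)`, `Y = (1, 1)`. The product of Pauli operators is the sum `P + P'`. -/
abbrev Pauli (Q : Type*) := Q → ZMod 2 × ZMod 2

/-- The commutation form: `0` if `P` and `P'` commute, `1` if they anticommute. -/
def Pauli.comm {Q : Type*} [Fintype Q] (P P' : Pauli Q) : ZMod 2 :=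
  ∑ u, ((P u).1 * (P' u).2 + (P u).2 * (P' u).1)

/-- The `ℓ∞`-distance between two elementary cubes (centre to centre) on the periodic lattice. -/
def cubeDist {L : ℕ} (c c' : Cube L) : ℕ :=
  Finset.univ.sup fun i => (c i - c' i).valMinAbs.natAbs

/-- A rectangular box on the dual lattice. It consists of the elementary cubes `c` with
`c i ∈ {corner i, corner i + 1, …, corner i + side i}` for each coordinate `i`. -/
structure Box (L : ℕ) where
  corner : Cube L
  side : Fin 3 → ℕ

/-- The elementary cubes (dual sites) lying in a box. -/
def Box.cubes {L : ℕ} (B : Box L) : Set (Cube L) :=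
  {c | ∀ i, (c i - B.corner i).val ≤ B.side i}

/-- The linear size (the `ℓ∞`-diameter) of a box. -/
def Box.size {L : ℕ} (B : Box L) : ℕ := Finset.univ.sup B.side

/-- The sites in the `1`-neighborhood of a box. In each coordinate the box is the interval
`[corner + 1/2, corner + side + 1/2]`, and the integers at distance at most `1` from it are
`corner, …, corner + side + 1`. -/
def Box.nbhd {L : ℕ} (B : Box L) : Set (Site L) :=
  {s | ∀ i, (s i - B.corner i).val ≤ B.side i + 1}

/-- A stabilizer code on the 3D periodic lattice of linear size `L`, with qubits `Q` placed at
sites and stabilizer generators `G` placed at elementary cubes. A generator acts only on qubits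
at the vertices of its cube, and generators commute pairwise. -/
structure LatticeCode (L : ℕ) (Q G : Type*) [Fintype Q] where
  site : Q → Site L
  cube : G → Cube L
  gen : G → Pauli Q
  gen_local : ∀ g u, gen g u ≠ 0 → ∀ i, site u i = cube g i ∨ site u i = cube g i + 1
  gen_comm : ∀ g g', Pauli.comm (gen g) (gen g') = 0

namespace LatticeCode

variable {L : ℕ} {Q G : Type*} [Fintype Q] [Fintype G] [DecidableEq G]

/-- The group of stabilizers, generated by the stabilizer generators. -/
def stabilizers (𝒞 : LatticeCode L Q G) : AddSubgroup (Pauli Q) :=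
  AddSubgroup.closure (Set.range 𝒞.gen)

/-- The syndrome of `P`: the set of defects, i.e. of generators anticommuting with `P`. -/
def syndrome (𝒞 : LatticeCode L Q G) (P : Pauli Q) : Finset G :=
  Finset.univ.filter fun g => Pauli.comm (𝒞.gen g) P = 1

/-- `P` acts trivially outside the set `W` of sites. -/
def SupportedOn (𝒞 : LatticeCode L Q G) (W : Set (Site L)) (P : Pauli Q) : Prop :=
  ∀ u, P u ≠ 0 → 𝒞.site u ∈ W

/-- `P` is supported on a cube of linear size `ℓ`, i.e. on a set of sites
`a + {0, 1, …, ⌊ℓ⌋}³`. -/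
def SupportedOnCube (𝒞 : LatticeCode L Q G) (ℓ : ℝ) (P : Pauli Q) : Prop :=
  ∃ a : Site L, 𝒞.SupportedOn {s | ∀ i, ((s i - a i).val : ℝ) ≤ ℓ} P

/-- The distance between two defects. -/
def defectDist (𝒞 : LatticeCode L Q G) (g g' : G) : ℕ := cubeDist (𝒞.cube g) (𝒞.cube g')

/-- The diameter of a cluster of defects. -/
def diam (𝒞 : LatticeCode L Q G) (C : Finset G) : ℕ :=
  (C ×ˢ C).sup fun x => 𝒞.defectDist x.1 x.2

/-- The box `B` encloses all defects of the cluster `C`. -/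
def Encloses (𝒞 : LatticeCode L Q G) (B : Box L) (C : Finset G) : Prop :=
  ∀ g ∈ C, 𝒞.cube g ∈ B.cubes

/-- `B` is a minimal enclosing box of the cluster `C`: its extent in every coordinate is the
smallest possible one. Only clusters that are large compared with `L` have several such boxes. -/
def IsMinBox (𝒞 : LatticeCode L Q G) (C : Finset G) (B : Box L) : Prop :=
  𝒞.Encloses B C ∧ ∀ B' : Box L, 𝒞.Encloses B' C → ∀ i, B.side i ≤ B'.side i

/-- Topological order at scale `ℓ`. -/
def HasTopologicalOrder (𝒞 : LatticeCode L Q G) (ℓ : ℝ) : Prop :=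
  ∀ P : Pauli Q, 𝒞.SupportedOnCube ℓ P →
    (𝒞.syndrome P = ∅ → P ∈ 𝒞.stabilizers) ∧
    (𝒞.syndrome P ≠ ∅ → ∃ B, 𝒞.IsMinBox (𝒞.syndrome P) B ∧
      ∃ g ∈ 𝒞.stabilizers, 𝒞.SupportedOn B.nbhd (P + g))

/-- A cluster of defects is neutral (at scale `ℓ`) if it can be created from the vacuum by a Pauli
operator supported on a cube of linear size `ℓ`. -/
def IsNeutral (𝒞 : LatticeCode L Q G) (ℓ : ℝ) (C : Finset G) : Prop :=
  ∃ P : Pauli Q, 𝒞.SupportedOnCube ℓ P ∧ 𝒞.syndrome P = C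

/-- `P` is a string segment with aspect ratio `β` (at scale `ℓ`) whose syndrome consists of the
two disjoint clusters `C₁` and `C₂`. -/
def IsStringSegment (𝒞 : LatticeCode L Q G) (ℓ β : ℝ) (P : Pauli Q) (C₁ C₂ : Finset G) : Prop :=
  𝒞.SupportedOnCube ℓ P ∧ Disjoint C₁ C₂ ∧ 𝒞.syndrome P = C₁ ∪ C₂ ∧
    ∃ r : ℝ, 1 ≤ r ∧ (𝒞.diam C₁ : ℝ) ≤ r ∧ (𝒞.diam C₂ : ℝ) ≤ r ∧
      ∀ g₁ ∈ C₁, ∀ g₂ ∈ C₂, β * r ≤ (𝒞.defectDist g₁ g₂ : ℝ)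

/-- The no-strings rule with constant `α`: every string segment with aspect ratio greater than
`α` is trivial, i.e. both of its clusters are neutral. -/
def NoStrings (𝒞 : LatticeCode L Q G) (ℓ α : ℝ) : Prop :=
  ∀ β : ℝ, α < β → ∀ P C₁ C₂, 𝒞.IsStringSegment ℓ β P C₁ C₂ →
    𝒞.IsNeutral ℓ C₁ ∧ 𝒞.IsNeutral ℓ C₂

/-- `Γ 0, Γ 1, …, Γ t` is an error path implementing `P`: it leads from the identity to `P`, and
consecutive operators differ on at most one qubit. -/
def IsErrorPath (Γ : ℕ → Pauli Q) (t : ℕ) (P : Pauli Q) : Prop :=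
  Γ 0 = 0 ∧ Γ t = P ∧
    ∀ i < t, ∀ u v, Γ i u ≠ Γ (i + 1) u → Γ i v ≠ Γ (i + 1) v → u = v

/-- The energy cost of a path: the maximal number of defects along it. -/
def energyCost (𝒞 : LatticeCode L Q G) (Γ : ℕ → Pauli Q) (t : ℕ) : ℕ :=
  (Finset.range (t + 1)).sup fun i => (𝒞.syndrome (Γ i)).card

/-- The energy barrier of `P`: the minimal energy cost of all error paths implementing `P`. -/
noncomputable def energyBarrier (𝒞 : LatticeCode L Q G) (P : Pauli Q) : ℕ :=
  sInf {k | ∃ Γ t, IsErrorPath Γ t P ∧ 𝒞.energyCost Γ t = k}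

/-- The cluster `C` is connected at scale `r`: it is not the union of two disjoint non-empty
clusters at distance greater than `r`. -/
def IsConnectedAt (𝒞 : LatticeCode L Q G) (r : ℕ) (C : Finset G) : Prop :=
  ∀ C₁ C₂ : Finset G, C₁.Nonempty → C₂.Nonempty → Disjoint C₁ C₂ → C₁ ∪ C₂ = C →
    ¬ ∀ g₁ ∈ C₁, ∀ g₂ ∈ C₂, r < 𝒞.defectDist g₁ g₂

open Classical in
/-- The `r`-connected components of `S`: its maximal non-empty `r`-connected subsets. -/
noncomputable def components (𝒞 : LatticeCode L Q G) (r : ℕ) (S : Finset G) :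
    Finset (Finset G) :=
  S.powerset.filter fun C => C.Nonempty ∧ 𝒞.IsConnectedAt r C ∧
    ∀ C' ⊆ S, 𝒞.IsConnectedAt r C' → C ⊆ C' → C' = C

/-- `T` is an implementation of the subroutine TestNeutral at scale `ℓ`: on input `S`, let `B` be
a minimal enclosing box of `S`. If `B` is larger than `ℓ`, return the identity. Otherwise return
some Pauli operator with syndrome `S` supported on the `1`-neighborhood of `B` if there is one,
and the identity if there is none. -/
def IsTestNeutral (𝒞 : LatticeCode L Q G) (ℓ : ℝ) (T : Finset G → Pauli Q) : Prop :=
  ∀ S : Finset G, ∃ B : Box L, 𝒞.IsMinBox S B ∧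
    (ℓ < (B.size : ℝ) → T S = 0) ∧
    ((B.size : ℝ) ≤ ℓ → (∃ P, 𝒞.SupportedOn B.nbhd P ∧ 𝒞.syndrome P = S) →
      𝒞.SupportedOn B.nbhd (T S) ∧ 𝒞.syndrome (T S) = S) ∧
    ((B.size : ℝ) ≤ ℓ → (¬ ∃ P, 𝒞.SupportedOn B.nbhd P ∧ 𝒞.syndrome P = S) → T S = 0)

/-- Level-`p` error correction EC(`p`). -/
noncomputable def EC (𝒞 : LatticeCode L Q G) (T : Finset G → Pauli Q) (p : ℕ) (S : Finset G) :
    Pauli Q :=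
  ∑ C ∈ 𝒞.components (2 ^ p) S, T C

/-- The number of levels, `p_M + 1`, where `p_M` is the largest integer `p ≥ 0` such that
`2 ^ p < min (L / 2) ℓ` (and zero if there is no such `p`): the levels are the integers
`0 ≤ p < numLevels L ℓ`. -/
noncomputable def numLevels (L : ℕ) (ℓ : ℝ) : ℕ :=
  sInf {n : ℕ | min ((L : ℝ) / 2) ℓ ≤ 2 ^ n}

/-- One pass of the loop of the RG decoder, acting on the pair `(P_ec, S)`. -/
noncomputable def rgStep (𝒞 : LatticeCode L Q G) (T : Finset G → Pauli Q)
    (st : Pauli Q × Finset G) (p : ℕ) : Pauli Q × Finset G :=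
  (st.1 + 𝒞.EC T p st.2, symmDiff st.2 (𝒞.syndrome (𝒞.EC T p st.2)))

/-- The RG decoder with the implementation `T` of TestNeutral; `none` means failure. -/
noncomputable def rgDecoder (𝒞 : LatticeCode L Q G) (ℓ : ℝ) (T : Finset G → Pauli Q)
    (S : Finset G) : Option (Pauli Q) :=
  let st := (List.range (numLevels L ℓ)).foldl (𝒞.rgStep T) (0, S)
  if st.2 = ∅ then some st.1 else none

/-- The RG decoder corrects the error `P`: called on the syndrome of `P`, it does not fail, and
returns an operator whose product with `P` is a stabilizer. -/
def Corrects (𝒞 : LatticeCode L Q G) (ℓ : ℝ) (T : Finset G → Pauli Q) (P : Pauli Q) : Prop :=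
  ∃ Pec, 𝒞.rgDecoder ℓ T (𝒞.syndrome P) = some Pec ∧ P + Pec ∈ 𝒞.stabilizers

end LatticeCode

/-- Every Pauli operator has an error path, so the energy barrier is a genuine minimum. -/
theorem LatticeCode.exists_isErrorPath {Q : Type*} [Fintype Q] (P : Pauli Q) :
    ∃ Γ t, LatticeCode.IsErrorPath Γ t P := by
  classical
  let e := Fintype.equivFin Q
  refine ⟨fun i u => if (e u).val < i then P u else 0, Fintype.card Q, ?_, ?_, ?_⟩
  · funext u; simp
  · funext u; simp
  · intro i _ u v hu hv
    have key : ∀ w, ((if (e w).val < i then P w else 0) ≠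
        (if (e w).val < i + 1 then P w else 0)) → (e w).val = i := by
      intro w hw
      by_contra hne
      apply hw
      have : (e w).val < i ↔ (e w).val < i + 1 := by omega
      simp only [this]
    exact e.injective (Fin.ext ((key u hu).trans (key v hv).symm))

/-- Every cluster has a minimal enclosing box. -/
theorem LatticeCode.exists_isMinBox {L : ℕ} {Q G : Type*} [Fintype Q]
    (𝒞 : LatticeCode L Q G) (C : Finset G) : ∃ B, 𝒞.IsMinBox C B := by
  classical
  have h : ∀ i : Fin 3, ∃ n : ℕ, ∃ a : ZMod L, ∀ g ∈ C, (𝒞.cube g i - a).val ≤ n := fun i =>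
    ⟨C.sup fun g => (𝒞.cube g i - 0).val, 0, fun g hg =>
      Finset.le_sup (f := fun g => (𝒞.cube g i - 0).val) hg⟩
  choose a ha using fun i => Nat.find_spec (h i)
  refine ⟨⟨a, fun i => Nat.find (h i)⟩, fun g hg i => ha i g hg, fun B' hB' i => ?_⟩
  exact Nat.find_min' (h i) ⟨B'.corner i, fun g hg => hB' g hg i⟩

/-- The subroutine TestNeutral has an implementation. -/
theorem LatticeCode.exists_isTestNeutral {L : ℕ} {Q G : Type*} [Fintype Q] [Fintype G]
    [DecidableEq G] (𝒞 : LatticeCode L Q G) (ℓ : ℝ) : ∃ T, 𝒞.IsTestNeutral ℓ T := by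
  classical
  have h : ∀ S : Finset G, ∃ R : Pauli Q, ∃ B : Box L, 𝒞.IsMinBox S B ∧
      (ℓ < (B.size : ℝ) → R = 0) ∧
      ((B.size : ℝ) ≤ ℓ → (∃ P, 𝒞.SupportedOn B.nbhd P ∧ 𝒞.syndrome P = S) →
        𝒞.SupportedOn B.nbhd R ∧ 𝒞.syndrome R = S) ∧
      ((B.size : ℝ) ≤ ℓ → (¬ ∃ P, 𝒞.SupportedOn B.nbhd P ∧ 𝒞.syndrome P = S) → R = 0) := by
    intro S
    obtain ⟨B, hB⟩ := 𝒞.exists_isMinBox S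
    by_cases hs : (B.size : ℝ) ≤ ℓ ∧ ∃ P, 𝒞.SupportedOn B.nbhd P ∧ 𝒞.syndrome P = S
    · obtain ⟨hs, P, hP⟩ := hs
      exact ⟨P, B, hB, fun h => absurd hs (not_le.mpr h), fun _ _ => hP,
        fun _ hn => absurd ⟨P, hP⟩ hn⟩
    · exact ⟨0, B, hB, fun _ => rfl, fun h1 h2 => absurd ⟨h1, h2⟩ hs, fun _ _ => rfl⟩
  choose T hT using h
  exact ⟨T, hT⟩

/-!
The proof has two parts: an error with a small energy barrier is equivalent, modulo stabilizers,
to one supported near its own defects, and the decoder corrects every error of the latter kind.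

*Localization.* A syndrome is sparse on a scale if its defects form clusters of diameter at most
`a` at mutual distances greater than `b`. On the scales `clusterScale α p`, where `b` is about
`(2 α + 10) a` and the next `a` is `2 a + b`, a syndrome with at most `m` defects is sparse on one
of the scales `p < m`, since otherwise two of its at most `m` clusters could be merged `m` times
(`exists_sparse`). Fix an optimal error path. By induction on `p`, if all syndromes strictly
between two times are sparse on scales below `p`, then the error accumulated between the two times
is equivalent to one supported near the two end syndromes (`localizable_of_forall_sparseAt`). In
the induction step one passes through times at which the syndrome is sparse on scale `p`, and the
gaps between clusters are so large that a chain of nearby clusters contains at most one cluster of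
each of the syndromes involved (`chainEnds_of_reflTransGen`). So clusters move individually. A
cluster that has moved by more than `α (a + 1)` is neutral by the no-strings rule, and the error can
be cut there; one that has not moved that far is joined to its initial position by a short operator,
by topological order (`localizable_of_three_sparse`). What is not connected to the end syndromes
has an empty syndrome and is a stabilizer (`localizable_of_two_sparse`). The radius grows by a
factor of at most `20 α` per scale, and `p = m` covers the whole path.

*Decoding.* Let `P'` be supported within distance `ρ` of its at most `m` defects. By the same
merging argument its syndrome consists of clusters of diameter at most `A` with gaps greater than
`B = 2 A + 2 ρ + 1`, where `A + ρ ≤ 4 ^ (m - 1) ρ`. Choose a level `n` with `A ≤ 2 ^ n ≤ B`. Up to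
this level the decoder never joins defects of different clusters, so that `P'` and all corrections
factor over the clusters (`SplitsOver`). At level `n` the components are what is left of the
clusters; each of them is the syndrome of a local factor, hence neutral, and is removed. The product
of `P'` and the correction then has local factors with empty syndromes, so it is a stabilizer
(`corrects_of_sparse`). The constant `80` is the product of the two growth factors `20` and `4`.
-/

/-! ### The `ℓ∞`-distance on the periodic lattice -/

theorem ZMod.natAbs_valMinAbs_le_iff {L : ℕ} [NeZero L] {x : ZMod L} {k : ℕ} :
    x.valMinAbs.natAbs ≤ k ↔ ∃ z : ℤ, z.natAbs ≤ k ∧ (z : ZMod L) = x := by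
  refine ⟨fun h => ⟨x.valMinAbs, h, x.coe_valMinAbs⟩, ?_⟩
  rintro ⟨z, hz, rfl⟩
  refine le_trans (ZMod.natAbs_min_of_le_div_two L _ z ?_ (ZMod.natAbs_valMinAbs_le _)) hz
  simp

theorem ZMod.val_le_iff {L : ℕ} [NeZero L] {x : ZMod L} {k : ℕ} :
    x.val ≤ k ↔ ∃ z : ℕ, z ≤ k ∧ (z : ZMod L) = x := by
  refine ⟨fun h => ⟨x.val, h, x.natCast_zmod_val⟩, ?_⟩
  rintro ⟨z, hz, rfl⟩
  rw [ZMod.val_natCast]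
  exact (Nat.mod_le _ _).trans hz

section Metric

variable {L : ℕ}

theorem cubeDist_le_iff {c c' : Cube L} {k : ℕ} :
    cubeDist c c' ≤ k ↔ ∀ i, (c i - c' i).valMinAbs.natAbs ≤ k := by
  simp [cubeDist, Finset.sup_le_iff]

theorem cubeDist_self (c : Cube L) : cubeDist c c = 0 := by
  simp [cubeDist]

theorem cubeDist_comm (c c' : Cube L) : cubeDist c c' = cubeDist c' c := by
  unfold cubeDist
  congr 1
  funext i
  rw [← ZMod.natAbs_valMinAbs_neg, neg_sub]

theorem cubeDist_triangle (x y z : Cube L) :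
    cubeDist x z ≤ cubeDist x y + cubeDist y z := by
  rw [cubeDist_le_iff]
  intro i
  have h1 := cubeDist_le_iff.1 (le_refl (cubeDist x y)) i
  have h2 := cubeDist_le_iff.1 (le_refl (cubeDist y z)) i
  have h3 := ZMod.natAbs_valMinAbs_add_le (x i - y i) (y i - z i)
  rw [sub_add_sub_cancel] at h3
  omega

variable [NeZero L]

theorem cubeDist_le_one_of_vertex {s c : Cube L} (h : ∀ i, s i = c i ∨ s i = c i + 1) :
    cubeDist s c ≤ 1 := by
  rw [cubeDist_le_iff]
  intro i
  rw [ZMod.natAbs_valMinAbs_le_iff]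
  rcases h i with h | h
  · exact ⟨0, by simp, by simp [h]⟩
  · exact ⟨1, by simp, by simp [h]⟩

theorem cubeDist_le_one_of_vertices {s s' c : Cube L} (h : ∀ i, s i = c i ∨ s i = c i + 1)
    (h' : ∀ i, s' i = c i ∨ s' i = c i + 1) : cubeDist s s' ≤ 1 := by
  rw [cubeDist_le_iff]
  intro i
  rw [ZMod.natAbs_valMinAbs_le_iff]
  rcases h i with h | h <;> rcases h' i with h' | h' <;> rw [h, h']
  · exact ⟨0, by simp, by simp⟩
  · exact ⟨-1, by simp, by simp⟩
  · exact ⟨1, by simp, by simp⟩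
  · exact ⟨0, by simp, by simp⟩

/-- A ball of radius `ρ` is contained in a cube of side `2ρ`. -/
theorem exists_corner_of_ball (x : Site L) (ρ : ℕ) :
    ∃ a : Site L, ∀ s : Site L, cubeDist s x ≤ ρ → ∀ i, (s i - a i).val ≤ 2 * ρ := by
  refine ⟨fun i => x i - (ρ : ZMod L), fun s hs i => ?_⟩
  obtain ⟨z, hz, hzx⟩ := ZMod.natAbs_valMinAbs_le_iff.1 (cubeDist_le_iff.1 hs i)
  rw [ZMod.val_le_iff]
  refine ⟨(z + ρ).toNat, by omega, ?_⟩
  have : (((z + ρ).toNat : ℤ) : ZMod L) = ((z + ρ : ℤ) : ZMod L) := by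
    rw [Int.toNat_of_nonneg (by omega)]
  rw [Int.cast_natCast] at this
  rw [this]
  push_cast
  rw [hzx]
  ring

/-- A site of the `1`-neighborhood of a box is at distance at most `k + 1` from each cube of the
box, if the sides of the box are at most `k`. -/
theorem Box.dist_le_of_mem_nbhd {B : Box L} {k : ℕ} (hB : ∀ i, B.side i ≤ k) {s c : Cube L}
    (hs : s ∈ B.nbhd) (hc : c ∈ B.cubes) : cubeDist s c ≤ k + 1 := by
  rw [cubeDist_le_iff]
  intro i
  rw [ZMod.natAbs_valMinAbs_le_iff]
  have h1 : (s i - B.corner i).val ≤ B.side i + 1 := hs i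
  have h2 : (c i - B.corner i).val ≤ B.side i := hc i
  have h3 := hB i
  refine ⟨(s i - B.corner i).val - (c i - B.corner i).val, by omega, ?_⟩
  push_cast
  rw [ZMod.natCast_zmod_val, ZMod.natCast_zmod_val]
  ring

/-- A finite nonempty set of residues of diameter at most `k < L / 3` lies in an interval of
length `k`. -/
theorem exists_interval_of_diam {ι : Type*} {C : Finset ι} (hC : C.Nonempty) (f : ι → ZMod L)
    {k : ℕ} (hk : 3 * k < L) (hd : ∀ g ∈ C, ∀ g' ∈ C, (f g - f g').valMinAbs.natAbs ≤ k) :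
    ∃ a : ZMod L, ∀ g ∈ C, (f g - a).val ≤ k := by
  obtain ⟨g₀, hg₀⟩ := hC
  obtain ⟨g₁, hg₁, hmin⟩ := Finset.exists_min_image C (fun g => (f g - f g₀).valMinAbs) ⟨g₀, hg₀⟩
  refine ⟨f g₁, fun g hg => ?_⟩
  have h0 := hd g hg g₀ hg₀
  have h1 := hd g₁ hg₁ g₀ hg₀
  have h2 := hmin g hg
  obtain ⟨z, hz, hzx⟩ := ZMod.natAbs_valMinAbs_le_iff.1 (hd g hg g₁ hg₁)
  set u := (f g - f g₀).valMinAbs with hu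
  set v := (f g₁ - f g₀).valMinAbs with hv
  have hcast : ((u - v : ℤ) : ZMod L) = f g - f g₁ := by
    push_cast
    rw [hu, hv, ZMod.coe_valMinAbs, ZMod.coe_valMinAbs]
    ring
  -- the two integer representatives of `f g - f g₁` differ by less than `L`
  have heq : u - v - z = 0 := by
    refine Int.eq_zero_of_abs_lt_dvd (m := L) ?_ ?_
    · rw [← ZMod.intCast_zmod_eq_zero_iff_dvd]
      push_cast at hcast ⊢
      rw [hcast, hzx, sub_self]
    · rw [abs_lt]
      omega
  rw [ZMod.val_le_iff]
  refine ⟨(u - v).toNat, by omega, ?_⟩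
  have : (((u - v).toNat : ℤ) : ZMod L) = ((u - v : ℤ) : ZMod L) := by
    rw [Int.toNat_of_nonneg (by omega)]
  rw [Int.cast_natCast] at this
  rw [this, hcast]

end Metric

namespace LatticeCode

variable {L : ℕ} {Q G : Type*} [Fintype Q] {𝒞 : LatticeCode L Q G}

theorem defectDist_self (g : G) : 𝒞.defectDist g g = 0 := cubeDist_self _

theorem defectDist_comm (g g' : G) : 𝒞.defectDist g g' = 𝒞.defectDist g' g := cubeDist_comm _ _

theorem defectDist_triangle (g₁ g₂ g₃ : G) :
    𝒞.defectDist g₁ g₃ ≤ 𝒞.defectDist g₁ g₂ + 𝒞.defectDist g₂ g₃ := cubeDist_triangle _ _ _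

theorem IsMinBox.side_le [NeZero L] {C : Finset G} {B : Box L} (hB : 𝒞.IsMinBox C B) (hC : C.Nonempty)
    {k : ℕ} (hk : 3 * k < L) (hd : ∀ g ∈ C, ∀ g' ∈ C, 𝒞.defectDist g g' ≤ k) (i : Fin 3) :
    B.side i ≤ k := by
  have h : ∀ i, ∃ a : ZMod L, ∀ g ∈ C, (𝒞.cube g i - a).val ≤ k := fun i =>
    exists_interval_of_diam hC (fun g => 𝒞.cube g i) hk
      fun g hg g' hg' => cubeDist_le_iff.1 (hd g hg g' hg') i
  choose a ha using h
  exact hB.2 ⟨a, fun _ => k⟩ (fun g hg i => ha i g hg) i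

/-- Every lower face of a minimal enclosing box carries a defect. -/
theorem IsMinBox.exists_corner [NeZero L] {C : Finset G} {B : Box L} (hB : 𝒞.IsMinBox C B)
    (hC : C.Nonempty) (i : Fin 3) : ∃ g ∈ C, 𝒞.cube g i = B.corner i := by
  classical
  by_contra! hne
  -- otherwise the box can be shrunk by moving its lower face up by one
  rcases Nat.eq_zero_or_pos (B.side i) with h0 | hpos
  · obtain ⟨g, hg⟩ := hC
    have h1 : (𝒞.cube g i - B.corner i).val ≤ B.side i := hB.1 g hg i
    rw [h0, Nat.le_zero, ZMod.val_eq_zero, sub_eq_zero] at h1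
    exact hne g hg h1
  · have henc : 𝒞.Encloses ⟨Function.update B.corner i (B.corner i + 1),
        Function.update B.side i (B.side i - 1)⟩ C := by
      intro g hg j
      have h1 : (𝒞.cube g j - B.corner j).val ≤ B.side j := hB.1 g hg j
      by_cases hj : j = i
      · subst hj
        simp only [Function.update_self]
        have hx : (𝒞.cube g j - B.corner j) ≠ 0 := sub_ne_zero.2 (hne g hg)
        have hv : (𝒞.cube g j - B.corner j).val ≠ 0 := by rwa [Ne, ZMod.val_eq_zero]
        rw [← sub_sub]
        rw [ZMod.val_le_iff]
        refine ⟨(𝒞.cube g j - B.corner j).val - 1, by omega, ?_⟩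
        rw [Nat.cast_sub (by omega), ZMod.natCast_zmod_val, Nat.cast_one]
      · simpa only [Function.update_of_ne hj] using h1
    have := hB.2 _ henc i
    simp only [Function.update_self] at this
    omega

theorem IsMinBox.nbhd_unique [NeZero L] {C : Finset G} {B B' : Box L} (hB : 𝒞.IsMinBox C B)
    (hB' : 𝒞.IsMinBox C B') (hC : C.Nonempty) (hk : ∀ i, 2 * B.side i < L) :
    B.nbhd = B'.nbhd := by
  have hside : ∀ i, B.side i = B'.side i := fun i =>
    le_antisymm (hB.2 _ hB'.1 i) (hB'.2 _ hB.1 i)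
  have hcorner : ∀ i, B.corner i = B'.corner i := by
    intro i
    obtain ⟨g, hg, hgi⟩ := hB.exists_corner hC i
    obtain ⟨g', hg', hgi'⟩ := hB'.exists_corner hC i
    have h1 : (𝒞.cube g i - B'.corner i).val ≤ B'.side i := hB'.1 g hg i
    have h2 : (𝒞.cube g' i - B.corner i).val ≤ B.side i := hB.1 g' hg' i
    rw [hgi] at h1
    rw [hgi', ← neg_sub, ZMod.neg_val] at h2
    split_ifs at h2 with h
    · exact sub_eq_zero.1 h
    · have := hk i
      have := hside i
      omega
  simp only [Box.nbhd, hside, hcorner]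

end LatticeCode

/-! ### Syndromes and stabilizers -/

namespace Pauli

variable {Q : Type*}

theorem add_self (P : Pauli Q) : P + P = 0 := by
  funext u
  exact Prod.ext (CharTwo.add_self_eq_zero _) (CharTwo.add_self_eq_zero _)

theorem add_eq_add_add_add (Γ : ℕ → Pauli Q) (i j k : ℕ) :
    Γ i + Γ k = (Γ i + Γ j) + (Γ j + Γ k) := by
  rw [add_assoc, ← add_assoc (Γ j), add_self, zero_add]

variable [Fintype Q]

theorem comm_add (P X Y : Pauli Q) : comm P (X + Y) = comm P X + comm P Y := by
  simp only [comm, ← Finset.sum_add_distrib]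
  refine Finset.sum_congr rfl fun u _ => ?_
  simp only [Pi.add_apply, Prod.fst_add, Prod.snd_add]
  ring

theorem comm_zero (P : Pauli Q) : comm P 0 = 0 := by simp [comm]

theorem comm_sum {ι : Type*} (P : Pauli Q) (s : Finset ι) (X : ι → Pauli Q) :
    comm P (∑ k ∈ s, X k) = ∑ k ∈ s, comm P (X k) := by
  classical
  induction s using Finset.induction_on with
  | empty => simp [comm_zero]
  | insert a s ha ih => rw [Finset.sum_insert ha, Finset.sum_insert ha, comm_add, ih]

theorem exists_of_comm_ne_zero {P X : Pauli Q} (h : comm P X ≠ 0) : ∃ u, P u ≠ 0 ∧ X u ≠ 0 := by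
  by_contra! hne
  refine h (Finset.sum_eq_zero fun u _ => ?_)
  by_cases hP : P u = 0
  · simp [hP]
  · simp [hne u hP]

theorem comm_congr {P X Y : Pauli Q} (h : ∀ u, P u ≠ 0 → X u = Y u) : comm P X = comm P Y := by
  refine Finset.sum_congr rfl fun u _ => ?_
  by_cases hP : P u = 0
  · simp [hP]
  · rw [h u hP]

end Pauli

namespace LatticeCode

variable {L : ℕ} {Q G : Type*} [Fintype Q] {𝒞 : LatticeCode L Q G}

theorem SupportedOn.mono {W W' : Set (Site L)} {X : Pauli Q} (h : 𝒞.SupportedOn W X)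
    (hW : W ⊆ W') : 𝒞.SupportedOn W' X := fun u hu => hW (h u hu)

theorem supportedOn_zero (W : Set (Site L)) : 𝒞.SupportedOn W (0 : Pauli Q) :=
  fun _ hu => absurd rfl hu

theorem SupportedOn.add {W : Set (Site L)} {X Y : Pauli Q} (hX : 𝒞.SupportedOn W X)
    (hY : 𝒞.SupportedOn W Y) : 𝒞.SupportedOn W (X + Y) := by
  intro u hu
  by_cases h : X u = 0
  · exact hY u fun h' => hu (by simp [h, h'])
  · exact hX u h

theorem supportedOnCube_of_ball [NeZero L] {ℓ : ℝ} {x : Site L} {ρ : ℕ} (hρ : 2 * (ρ : ℝ) ≤ ℓ)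
    {X : Pauli Q} (hX : 𝒞.SupportedOn {s | cubeDist s x ≤ ρ} X) : 𝒞.SupportedOnCube ℓ X := by
  obtain ⟨a, ha⟩ := exists_corner_of_ball x ρ
  refine ⟨a, fun u hu i => le_trans ?_ hρ⟩
  exact_mod_cast ha _ (hX u hu) i

/-- `X` is equivalent, modulo stabilizers, to a Pauli operator supported on `W`. -/
def Localizable (𝒞 : LatticeCode L Q G) (W : Set (Site L)) (X : Pauli Q) : Prop :=
  ∃ Y, 𝒞.SupportedOn W Y ∧ X + Y ∈ 𝒞.stabilizers

theorem Localizable.mono {W W' : Set (Site L)} {X : Pauli Q} (h : 𝒞.Localizable W X)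
    (hW : W ⊆ W') : 𝒞.Localizable W' X :=
  let ⟨Y, hY, hs⟩ := h
  ⟨Y, hY.mono hW, hs⟩

theorem localizable_of_mem_stabilizers {W : Set (Site L)} {X : Pauli Q}
    (h : X ∈ 𝒞.stabilizers) : 𝒞.Localizable W X := ⟨0, supportedOn_zero W, by simpa using h⟩

theorem SupportedOn.localizable {W : Set (Site L)} {X : Pauli Q} (h : 𝒞.SupportedOn W X) :
    𝒞.Localizable W X := ⟨X, h, by rw [Pauli.add_self]; exact zero_mem _⟩

theorem Localizable.add {W : Set (Site L)} {X Y : Pauli Q} (hX : 𝒞.Localizable W X)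
    (hY : 𝒞.Localizable W Y) : 𝒞.Localizable W (X + Y) := by
  obtain ⟨X', hX', hsX⟩ := hX
  obtain ⟨Y', hY', hsY⟩ := hY
  refine ⟨X' + Y', hX'.add hY', ?_⟩
  rw [add_add_add_comm]
  exact add_mem hsX hsY

theorem Localizable.sum {ι : Type*} {W : Set (Site L)} {s : Finset ι} {X : ι → Pauli Q}
    (h : ∀ k ∈ s, 𝒞.Localizable W (X k)) : 𝒞.Localizable W (∑ k ∈ s, X k) := by
  classical
  induction s using Finset.induction_on with
  | empty => exact localizable_of_mem_stabilizers (by simp)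
  | insert a s ha ih =>
    rw [Finset.sum_insert ha]
    exact (h a (Finset.mem_insert_self _ _)).add
      (ih fun k hk => h k (Finset.mem_insert_of_mem hk))

/-- Localizability only depends on the class modulo stabilizers. -/
theorem Localizable.of_add_mem {W : Set (Site L)} {X Y : Pauli Q} (hY : 𝒞.Localizable W Y)
    (h : X + Y ∈ 𝒞.stabilizers) : 𝒞.Localizable W X := by
  have : X = (X + Y) + Y := by rw [add_assoc, Pauli.add_self, add_zero]
  rw [this]
  exact (localizable_of_mem_stabilizers h).add hY

theorem cubeDist_le_one_of_gen [NeZero L] {g : G} {u : Q} (h : 𝒞.gen g u ≠ 0) :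
    cubeDist (𝒞.site u) (𝒞.cube g) ≤ 1 := cubeDist_le_one_of_vertex (𝒞.gen_local g u h)

theorem comm_gen_of_mem_stabilizers {X : Pauli Q} (h : X ∈ 𝒞.stabilizers) (g : G) :
    Pauli.comm (𝒞.gen g) X = 0 := by
  induction h using AddSubgroup.closure_induction with
  | mem x hx => obtain ⟨g', rfl⟩ := hx; exact 𝒞.gen_comm g g'
  | zero => exact Pauli.comm_zero _
  | add x y _ _ hx hy => rw [Pauli.comm_add, hx, hy, add_zero]
  | neg x _ hx =>
    have : -x = x := neg_eq_of_add_eq_zero_left (Pauli.add_self x)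
    rw [this, hx]

open Classical in
/-- The restriction of a Pauli operator to a set of sites. -/
noncomputable def restrict (𝒞 : LatticeCode L Q G) (A : Set (Site L)) (X : Pauli Q) : Pauli Q :=
  fun u => if 𝒞.site u ∈ A then X u else 0

theorem supportedOn_restrict (A : Set (Site L)) (X : Pauli Q) :
    𝒞.SupportedOn A (𝒞.restrict A X) := by
  intro u hu
  by_contra h
  exact hu (by simp [restrict, h])

/-- An operator supported on well separated regions is the sum of its restrictions. -/
theorem eq_sum_restrict {ι : Type*} {𝒦 : Finset ι} {A : ι → Set (Site L)} {X : Pauli Q}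
    (hcover : ∀ u, X u ≠ 0 → ∃ k ∈ 𝒦, 𝒞.site u ∈ A k)
    (hsep : ∀ k ∈ 𝒦, ∀ k' ∈ 𝒦, ∀ s ∈ A k, ∀ s' ∈ A k', cubeDist s s' ≤ 1 → k = k') :
    X = ∑ k ∈ 𝒦, 𝒞.restrict (A k) X := by
  funext u
  rw [Finset.sum_apply]
  by_cases hu : X u = 0
  · rw [hu, Finset.sum_eq_zero]
    intro k _
    simp [restrict, hu]
  · obtain ⟨k, hk, huk⟩ := hcover u hu
    rw [Finset.sum_eq_single_of_mem k hk]
    · simp [restrict, huk]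
    · intro k' hk' hne
      refine if_neg fun huk' => hne ?_
      exact hsep _ hk' _ hk _ huk' _ huk (by simp [cubeDist_self])

variable [Fintype G]

theorem mem_syndrome {P : Pauli Q} {g : G} :
    g ∈ 𝒞.syndrome P ↔ Pauli.comm (𝒞.gen g) P = 1 := by simp [syndrome]

theorem notMem_syndrome {P : Pauli Q} {g : G} :
    g ∉ 𝒞.syndrome P ↔ Pauli.comm (𝒞.gen g) P = 0 := by
  rw [mem_syndrome]
  generalize Pauli.comm (𝒞.gen g) P = x
  revert x
  decide

theorem syndrome_zero : 𝒞.syndrome (0 : Pauli Q) = ∅ :=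
  Finset.eq_empty_of_forall_notMem fun _ => notMem_syndrome.2 (Pauli.comm_zero _)

theorem syndrome_add [DecidableEq G] (P P' : Pauli Q) :
    𝒞.syndrome (P + P') = symmDiff (𝒞.syndrome P) (𝒞.syndrome P') := by
  ext g
  rw [Finset.mem_symmDiff, notMem_syndrome, notMem_syndrome, mem_syndrome, mem_syndrome,
    mem_syndrome, Pauli.comm_add]
  generalize Pauli.comm (𝒞.gen g) P = x
  generalize Pauli.comm (𝒞.gen g) P' = y
  revert x y
  decide

theorem syndrome_eq_empty_of_mem_stabilizers {X : Pauli Q} (h : X ∈ 𝒞.stabilizers) :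
    𝒞.syndrome X = ∅ :=
  Finset.eq_empty_of_forall_notMem fun g => notMem_syndrome.2 (comm_gen_of_mem_stabilizers h g)

theorem syndrome_eq_of_add_mem {X Y : Pauli Q} (h : X + Y ∈ 𝒞.stabilizers) :
    𝒞.syndrome X = 𝒞.syndrome Y := by
  classical
  have := syndrome_eq_empty_of_mem_stabilizers h
  rwa [syndrome_add, ← Finset.bot_eq_empty, symmDiff_eq_bot] at this

theorem exists_site_of_mem_syndrome [NeZero L] {X : Pauli Q} {g : G} (h : g ∈ 𝒞.syndrome X) :
    ∃ u, X u ≠ 0 ∧ cubeDist (𝒞.site u) (𝒞.cube g) ≤ 1 := by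
  rw [mem_syndrome] at h
  obtain ⟨u, hu, hX⟩ := Pauli.exists_of_comm_ne_zero (P := 𝒞.gen g) (X := X) (by rw [h]; decide)
  exact ⟨u, hX, cubeDist_le_one_of_gen hu⟩

/-! ### Restriction of a Pauli operator to well separated regions -/

section Regions

variable {ι : Type*} {𝒦 : Finset ι} {A : ι → Set (Site L)} {X : Pauli Q}

variable [NeZero L]

theorem mem_syndrome_restrict_of_forall {k : ι} {g : G} (hg : g ∈ 𝒞.syndrome X)
    (h : ∀ u, X u ≠ 0 → cubeDist (𝒞.site u) (𝒞.cube g) ≤ 1 → 𝒞.site u ∈ A k) :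
    g ∈ 𝒞.syndrome (𝒞.restrict (A k) X) := by
  rw [mem_syndrome] at hg ⊢
  rw [← hg]
  refine Pauli.comm_congr fun u hu => ?_
  by_cases hX : X u = 0
  · simp [restrict, hX]
  · exact if_pos (h u hX (cubeDist_le_one_of_gen hu))

theorem mem_syndrome_of_mem_syndrome_restrict
    (hcover : ∀ u, X u ≠ 0 → ∃ k ∈ 𝒦, 𝒞.site u ∈ A k)
    (hsep : ∀ k ∈ 𝒦, ∀ k' ∈ 𝒦, ∀ s ∈ A k, ∀ s' ∈ A k', cubeDist s s' ≤ 1 → k = k')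
    {k : ι} (hk : k ∈ 𝒦) {g : G} (hg : g ∈ 𝒞.syndrome (𝒞.restrict (A k) X)) :
    g ∈ 𝒞.syndrome X := by
  rw [mem_syndrome] at hg ⊢
  obtain ⟨u, hu, hXu⟩ :=
    Pauli.exists_of_comm_ne_zero (P := 𝒞.gen g) (X := 𝒞.restrict (A k) X) (by rw [hg]; decide)
  have huA := supportedOn_restrict (A k) X u hXu
  rw [← hg]
  refine Pauli.comm_congr fun v hv => ?_
  by_cases hX : X v = 0
  · simp [restrict, hX]
  · obtain ⟨k', hk', hvk'⟩ := hcover v hX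
    have := hsep k hk k' hk' _ huA _ hvk'
      (cubeDist_le_one_of_vertices (𝒞.gen_local g u hu) (𝒞.gen_local g v hv))
    subst this
    exact (if_pos hvk').symm

end Regions

/-! ### Consequences of topological order -/

section TopologicalOrder

variable [NeZero L] {ℓ : ℝ} {k : ℕ}

/-- Topological order moves an operator with a nonempty syndrome close to all of its defects. -/
theorem HasTopologicalOrder.exists_nbhd (htop : 𝒞.HasTopologicalOrder ℓ) {X : Pauli Q}
    (hX : 𝒞.SupportedOnCube ℓ X) (hne : (𝒞.syndrome X).Nonempty) (hk : 3 * k < L)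
    (hd : ∀ g ∈ 𝒞.syndrome X, ∀ g' ∈ 𝒞.syndrome X, 𝒞.defectDist g g' ≤ k) :
    ∃ Y, 𝒞.SupportedOn {s | ∀ g ∈ 𝒞.syndrome X, cubeDist s (𝒞.cube g) ≤ k + 1} Y ∧
      X + Y ∈ 𝒞.stabilizers := by
  obtain ⟨B, hB, g, hg, hs⟩ := (htop X hX).2 hne.ne_empty
  refine ⟨X + g, hs.mono fun s hs g hg => ?_, ?_⟩
  · exact Box.dist_le_of_mem_nbhd (hB.side_le hne hk hd) hs (hB.1 g hg)
  · rwa [← add_assoc, Pauli.add_self, zero_add]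

theorem HasTopologicalOrder.localizable (htop : 𝒞.HasTopologicalOrder ℓ) {X : Pauli Q}
    (hX : 𝒞.SupportedOnCube ℓ X) (hk : 3 * k < L)
    (hd : ∀ g ∈ 𝒞.syndrome X, ∀ g' ∈ 𝒞.syndrome X, 𝒞.defectDist g g' ≤ k) {W : Set (Site L)}
    (hW : ∀ g₀ ∈ 𝒞.syndrome X, ∀ s, (∀ g ∈ 𝒞.syndrome X, cubeDist s (𝒞.cube g) ≤ k + 1) →
      s ∈ W) : 𝒞.Localizable W X := by
  rcases (𝒞.syndrome X).eq_empty_or_nonempty with h | h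
  · exact localizable_of_mem_stabilizers ((htop X hX).1 h)
  · obtain ⟨Y, hY, hs⟩ := htop.exists_nbhd hX h hk hd
    obtain ⟨g₀, hg₀⟩ := h
    exact ⟨Y, hY.mono fun s hs => hW g₀ hg₀ s hs, hs⟩

/-- A small neutral cluster can be created by an operator supported close to it. -/
theorem IsNeutral.exists_nbhd (htop : 𝒞.HasTopologicalOrder ℓ) {C : Finset G}
    (hC : 𝒞.IsNeutral ℓ C) (hk : 3 * k < L) (hd : ∀ g ∈ C, ∀ g' ∈ C, 𝒞.defectDist g g' ≤ k) :
    ∃ Y, 𝒞.SupportedOn {s | ∃ g ∈ C, cubeDist s (𝒞.cube g) ≤ k + 1} Y ∧ 𝒞.syndrome Y = C := by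
  obtain ⟨X, hX, rfl⟩ := hC
  obtain ⟨Y, hY, hs⟩ := htop.localizable hX hk hd
    (W := {s | ∃ g ∈ 𝒞.syndrome X, cubeDist s (𝒞.cube g) ≤ k + 1})
    fun g₀ hg₀ s hs => ⟨g₀, hg₀, hs g₀ hg₀⟩
  exact ⟨Y, hY, (syndrome_eq_of_add_mem hs).symm⟩

end TopologicalOrder

/-- No-strings rule for two clusters of diameter at most `a` at distance greater than
`t ≥ ⌊α (a + 1)⌋`; either of them may be empty. -/
theorem NoStrings.isNeutral [DecidableEq G] {ℓ α : ℝ} (hns : 𝒞.NoStrings ℓ α) {a t : ℕ}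
    (ht : α * (a + 1) < t + 1) {X : Pauli Q} (hX : 𝒞.SupportedOnCube ℓ X) {C F : Finset G}
    (hs : 𝒞.syndrome X = C ∪ F) (hC : ∀ g ∈ C, ∀ g' ∈ C, 𝒞.defectDist g g' ≤ a)
    (hF : ∀ g ∈ F, ∀ g' ∈ F, 𝒞.defectDist g g' ≤ a)
    (hCF : ∀ g ∈ C, ∀ g' ∈ F, t < 𝒞.defectDist g g') :
    𝒞.IsNeutral ℓ C ∧ 𝒞.IsNeutral ℓ F := by
  have ha : (0 : ℝ) < a + 1 := by positivity
  refine hns ((t + 1) / (a + 1)) ((lt_div_iff₀ ha).2 ht) X C F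
    ⟨hX, ?_, hs, a + 1, by simp, ?_, ?_, ?_⟩
  · rw [Finset.disjoint_left]
    intro g hg hg'
    have := hCF g hg g hg'
    rw [defectDist_self] at this
    omega
  · have : 𝒞.diam C ≤ a := Finset.sup_le fun x hx =>
      hC _ (Finset.mem_product.1 hx).1 _ (Finset.mem_product.1 hx).2
    exact_mod_cast this.trans (Nat.le_succ a)
  · have : 𝒞.diam F ≤ a := Finset.sup_le fun x hx =>
      hF _ (Finset.mem_product.1 hx).1 _ (Finset.mem_product.1 hx).2
    exact_mod_cast this.trans (Nat.le_succ a)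
  · intro g hg g' hg'
    rw [div_mul_cancel₀ _ ha.ne']
    exact_mod_cast hCF g hg g' hg'

end LatticeCode

/-! ### Chains of defects belonging to three sparse syndromes -/

namespace LatticeCode

variable {L : ℕ} {Q G : Type*} [Fintype Q] {𝒞 : LatticeCode L Q G}

/-- The relation `d ≤ a` splits `S` into clusters of diameter at most `a` at mutual distances
greater than `b`. (If `2 * a ≤ b` this relation is transitive on `S`.) -/
def Sparse (𝒞 : LatticeCode L Q G) (a b : ℕ) (S : Finset G) : Prop :=
  ∀ g ∈ S, ∀ g' ∈ S, 𝒞.defectDist g g' ≤ a ∨ b < 𝒞.defectDist g g'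

/-- Given three syndromes `S i` and radii `ρ i`, two labelled defects `(i, g)` and `(j, h)` are
linked if the balls of radii `ρ i` and `ρ j` around them may be at distance at most one. -/
def Linked (𝒞 : LatticeCode L Q G) (S : Fin 3 → Finset G) (ρ : Fin 3 → ℕ)
    (x y : Fin 3 × G) : Prop :=
  x.2 ∈ S x.1 ∧ y.2 ∈ S y.1 ∧ 𝒞.defectDist x.2 y.2 ≤ ρ x.1 + ρ y.1 + 1

/-- The possible relative positions of the ends of a chain of linked defects: `y` belongs to the
cluster of `x`, or to a cluster linked to it directly, or to a cluster linked to it through one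
cluster of the remaining syndrome. -/
def ChainEnds (𝒞 : LatticeCode L Q G) (S : Fin 3 → Finset G) (ρ : Fin 3 → ℕ) (a : ℕ)
    (x y : Fin 3 × G) : Prop :=
  (y.1 = x.1 ∧ 𝒞.defectDist x.2 y.2 ≤ a) ∨
  (y.1 ≠ x.1 ∧ ∃ p ∈ S x.1, ∃ q ∈ S y.1, 𝒞.defectDist x.2 p ≤ a ∧
    𝒞.defectDist p q ≤ ρ x.1 + ρ y.1 + 1 ∧ 𝒞.defectDist q y.2 ≤ a) ∨
  (y.1 ≠ x.1 ∧ ∃ l, l ≠ x.1 ∧ l ≠ y.1 ∧ ∃ p ∈ S x.1, ∃ q ∈ S l, ∃ q' ∈ S l, ∃ r ∈ S y.1,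
    𝒞.defectDist x.2 p ≤ a ∧ 𝒞.defectDist p q ≤ ρ x.1 + ρ l + 1 ∧ 𝒞.defectDist q q' ≤ a ∧
    𝒞.defectDist q' r ≤ ρ l + ρ y.1 + 1 ∧ 𝒞.defectDist r y.2 ≤ a)

variable {S : Fin 3 → Finset G} {ρ : Fin 3 → ℕ} {a b : ℕ}

theorem Linked.symm {x y : Fin 3 × G} (h : 𝒞.Linked S ρ x y) : 𝒞.Linked S ρ y x :=
  ⟨h.2.1, h.1, by rw [defectDist_comm]; have := h.2.2; omega⟩

/-- If the gaps between the clusters are so large that a cluster cannot be linked to another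
cluster of the same syndrome through clusters of the two other syndromes, then every chain meets
at most one cluster of each syndrome. -/
theorem chainEnds_of_reflTransGen (hS : ∀ i, 𝒞.Sparse a b (S i))
    (hb : 2 * (ρ 0 + ρ 1 + ρ 2) + 2 * a + 3 ≤ b) {x y : Fin 3 × G} (hx : x.2 ∈ S x.1)
    (h : Relation.ReflTransGen (𝒞.Linked S ρ) x y) :
    y.2 ∈ S y.1 ∧ 𝒞.ChainEnds S ρ a x y := by
  have hs1 : ∀ i : Fin 3, ρ i ≤ ρ 0 + ρ 1 + ρ 2 := by
    intro i; fin_cases i <;> simp <;> omega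
  have hs2 : ∀ i j : Fin 3, i ≠ j → ρ i + ρ j ≤ ρ 0 + ρ 1 + ρ 2 := by
    intro i j hij; fin_cases i <;> fin_cases j <;> simp at hij ⊢ <;> omega
  have hs3 : ∀ i j k : Fin 3, i ≠ j → i ≠ k → j ≠ k → ρ i + ρ j + ρ k = ρ 0 + ρ 1 + ρ 2 := by
    intro i j k hij hik hjk
    fin_cases i <;> fin_cases j <;> fin_cases k <;> simp at hij hik hjk ⊢ <;> omega
  have hcase : ∀ i j k m : Fin 3, i ≠ j → i ≠ k → j ≠ k → m = i ∨ m = j ∨ m = k := by decide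
  -- distances below the gap are distances within a cluster
  have near : ∀ i, ∀ g ∈ S i, ∀ g' ∈ S i, 𝒞.defectDist g g' ≤ b → 𝒞.defectDist g g' ≤ a :=
    fun i g hg g' hg' hd => (hS i g hg g' hg').resolve_right (by omega)
  have tri := fun g₁ g₂ g₃ => defectDist_triangle (𝒞 := 𝒞) g₁ g₂ g₃
  induction h with
  | refl => exact ⟨hx, Or.inl ⟨rfl, by rw [defectDist_self]; omega⟩⟩
  | @tail y z _ hyz ih =>
    obtain ⟨hy, hz, hd⟩ := hyz
    refine ⟨hz, ?_⟩
    obtain ⟨ix, gx⟩ := x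
    obtain ⟨iy, gy⟩ := y
    obtain ⟨iz, gz⟩ := z
    obtain ⟨_, hxy⟩ := ih
    unfold ChainEnds at hxy ⊢
    dsimp only at *
    have hsy := hs1 iy
    rcases hxy with ⟨rfl, h1⟩ | ⟨hne, p, hp, q, hq, h1, h2, h3⟩ |
      ⟨hne, l, hlx, hly, p, hp, q, hq, q', hq', r, hr, h1, h2, h3, h4, h5⟩
    · by_cases hzi : iz = iy
      · subst hzi
        have := tri gx gy gz
        exact Or.inl ⟨rfl, near _ _ hx _ hz (by omega)⟩
      · exact Or.inr (Or.inl ⟨hzi, gy, hy, gz, hz, h1, hd, by simp [defectDist_self]⟩)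
    · have hsxy := hs2 ix iy (Ne.symm hne)
      by_cases hzy : iz = iy
      · subst hzy
        have := tri q gy gz
        exact Or.inr (Or.inl ⟨hne, p, hp, q, hq, h1, h2, near _ _ hq _ hz (by omega)⟩)
      by_cases hzx : iz = ix
      · subst hzx
        have h6 := tri p q gz
        have h7 := tri q gy gz
        have h8 := near _ _ hp _ hz (by omega)
        have h9 := tri gx p gz
        exact Or.inl ⟨rfl, near _ _ hx _ hz (by omega)⟩
      · exact Or.inr (Or.inr ⟨hzx, iy, hne, Ne.symm hzy, p, hp, q, hq, gy, hy, gz, hz, h1, h2, h3,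
          hd, by simp [defectDist_self]⟩)
    · have hsum := hs3 ix l iy (Ne.symm hlx) (Ne.symm hne) hly
      rcases hcase ix l iy iz (Ne.symm hlx) (Ne.symm hne) hly with rfl | rfl | rfl
      · have h6 := tri p q gz
        have h7 := tri q q' gz
        have h8 := tri q' r gz
        have h9 := tri r gy gz
        have h10 := near _ _ hp _ hz (by omega)
        have h11 := tri gx p gz
        exact Or.inl ⟨rfl, near _ _ hx _ hz (by omega)⟩
      · have h6 := tri q' r gz
        have h7 := tri r gy gz
        have h8 := near _ _ hq' _ hz (by omega)
        have h9 := tri q q' gz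
        exact Or.inr (Or.inl ⟨hlx, p, hp, q, hq, h1, h2, near _ _ hq _ hz (by omega)⟩)
      · have h6 := tri r gy gz
        exact Or.inr (Or.inr ⟨hne, l, hlx, hly, p, hp, q, hq, q', hq', r, hr, h1, h2, h3, h4,
          near _ _ hr _ hz (by omega)⟩)

theorem ChainEnds.dist_le {x y : Fin 3 × G} (h : 𝒞.ChainEnds S ρ a x y) :
    𝒞.defectDist x.2 y.2 ≤ 3 * a + 2 * (ρ 0 + ρ 1 + ρ 2) + 2 := by
  have hs2 : ∀ i j : Fin 3, i ≠ j → ρ i + ρ j ≤ ρ 0 + ρ 1 + ρ 2 := by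
    intro i j hij; fin_cases i <;> fin_cases j <;> simp at hij ⊢ <;> omega
  have tri := fun g₁ g₂ g₃ => defectDist_triangle (𝒞 := 𝒞) g₁ g₂ g₃
  rcases h with ⟨_, h1⟩ | ⟨hne, p, hp, q, hq, h1, h2, h3⟩ |
    ⟨hne, l, hlx, hly, p, hp, q, hq, q', hq', r, hr, h1, h2, h3, h4, h5⟩
  · omega
  · have := hs2 _ _ hne
    have := tri x.2 p y.2
    have := tri p q y.2
    omega
  · have := hs2 _ _ hlx
    have := hs2 _ _ hly
    have := tri x.2 p y.2
    have := tri p q y.2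
    have := tri q q' y.2
    have := tri q' r y.2
    omega

theorem ChainEnds.dist_le_of_eq {x y : Fin 3 × G} (h : 𝒞.ChainEnds S ρ a x y)
    (hxy : y.1 = x.1) : 𝒞.defectDist x.2 y.2 ≤ a := by
  rcases h with ⟨_, h1⟩ | ⟨hne, _⟩ | ⟨hne, _⟩
  · exact h1
  · exact absurd hxy hne
  · exact absurd hxy hne

/-- Chains inside the first two syndromes. -/
theorem ChainEnds.dist_le_of_two {x y : Fin 3 × G} (h : 𝒞.ChainEnds S ρ a x y)
    (h2 : S 2 = ∅) (hx : x.2 ∈ S x.1) (hy : y.2 ∈ S y.1) (hxy : y.1 ≠ x.1) :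
    𝒞.defectDist x.2 y.2 ≤ 2 * a + ρ 0 + ρ 1 + 1 := by
  have hx2 : x.1 ≠ 2 := fun h => by simp [h, h2] at hx
  have hy2 : y.1 ≠ 2 := fun h => by simp [h, h2] at hy
  have hs2 : ∀ i j : Fin 3, i ≠ 2 → j ≠ 2 → i ≠ j → ρ i + ρ j = ρ 0 + ρ 1 := by
    intro i j hi hj hij
    fin_cases i <;> fin_cases j <;> simp at hi hj hij ⊢
    exact add_comm _ _
  rcases h with ⟨h1, _⟩ | ⟨hne, p, hp, q, hq, h1, h3, h4⟩ | ⟨hne, l, hlx, hly, p, hp, q, hq, _⟩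
  · exact absurd h1 hxy
  · have := hs2 _ _ hx2 hy2 hne.symm
    have := defectDist_triangle (𝒞 := 𝒞) x.2 p y.2
    have := defectDist_triangle (𝒞 := 𝒞) p q y.2
    omega
  · have : ∀ i j l : Fin 3, i ≠ 2 → j ≠ 2 → i ≠ j → l ≠ i → l ≠ j → l = 2 := by decide
    rw [this _ _ l hx2 hy2 hne.symm hlx hly, h2] at hq
    simp at hq

end LatticeCode

/-! ### Decomposition of an operator into pieces along chains -/

namespace LatticeCode

variable {L : ℕ} {Q G : Type*} [Fintype Q] {𝒞 : LatticeCode L Q G}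

/-- The sites at distance at most `r` from the defects of `C`. Sites are compared with the lowest
vertices of cubes, so a generator of cube `c` acts within distance `1` of `c`. -/
def nbhd (𝒞 : LatticeCode L Q G) (C : Finset G) (r : ℕ) : Set (Site L) :=
  {s | ∃ g ∈ C, cubeDist s (𝒞.cube g) ≤ r}

theorem nbhd_mono {C C' : Finset G} {r r' : ℕ} (hC : C ⊆ C') (hr : r ≤ r') :
    𝒞.nbhd C r ⊆ 𝒞.nbhd C' r' := fun _ ⟨g, hg, h⟩ => ⟨g, hC hg, h.trans hr⟩

/-- The union of the balls around all labelled defects that are joined to `x` by a chain. -/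
def chainRegion (𝒞 : LatticeCode L Q G) (S : Fin 3 → Finset G) (ρ : Fin 3 → ℕ)
    (x : Fin 3 × G) : Set (Site L) :=
  {s | ∃ y : Fin 3 × G, y.2 ∈ S y.1 ∧ Relation.ReflTransGen (𝒞.Linked S ρ) x y ∧
    cubeDist s (𝒞.cube y.2) ≤ ρ y.1}

variable {S : Fin 3 → Finset G} {ρ : Fin 3 → ℕ} {X : Pauli Q}

theorem chain_symm {x y : Fin 3 × G} (h : Relation.ReflTransGen (𝒞.Linked S ρ) x y) :
    Relation.ReflTransGen (𝒞.Linked S ρ) y x := by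
  induction h with
  | refl => exact .refl
  | tail _ h ih => exact ih.head h.symm

theorem linked_of_near {x y : Fin 3 × G} (hx : x.2 ∈ S x.1) (hy : y.2 ∈ S y.1) {s s' : Site L}
    (hs : cubeDist s (𝒞.cube x.2) ≤ ρ x.1) (hs' : cubeDist s' (𝒞.cube y.2) ≤ ρ y.1)
    (h : cubeDist s s' ≤ 1) : 𝒞.Linked S ρ x y := by
  refine ⟨hx, hy, ?_⟩
  have h1 := cubeDist_triangle (𝒞.cube x.2) s (𝒞.cube y.2)
  have h2 := cubeDist_triangle s s' (𝒞.cube y.2)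
  rw [cubeDist_comm (𝒞.cube x.2) s] at h1
  unfold defectDist
  omega

theorem chainRegion_eq_of_chain {x y : Fin 3 × G}
    (h : Relation.ReflTransGen (𝒞.Linked S ρ) x y) :
    𝒞.chainRegion S ρ x = 𝒞.chainRegion S ρ y := by
  ext s
  exact ⟨fun ⟨z, hz, hxz, hs⟩ => ⟨z, hz, (chain_symm h).trans hxz, hs⟩,
    fun ⟨z, hz, hyz, hs⟩ => ⟨z, hz, h.trans hyz, hs⟩⟩

theorem chain_of_near_chainRegion {x y : Fin 3 × G} (hy : y.2 ∈ S y.1) {s s' : Site L}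
    (hs : s ∈ 𝒞.chainRegion S ρ x) (hs' : cubeDist s' (𝒞.cube y.2) ≤ ρ y.1)
    (h : cubeDist s s' ≤ 1) : Relation.ReflTransGen (𝒞.Linked S ρ) x y := by
  obtain ⟨z, hz, hxz, hsz⟩ := hs
  exact hxz.tail (linked_of_near hz hy hsz hs' h)

variable [Fintype G]

open Classical in
/-- The regions of all chains. -/
noncomputable def chainRegions (𝒞 : LatticeCode L Q G) (S : Fin 3 → Finset G) (ρ : Fin 3 → ℕ) :
    Finset (Set (Site L)) :=
  (Finset.univ.filter fun x : Fin 3 × G => x.2 ∈ S x.1).image (𝒞.chainRegion S ρ)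

theorem mem_chainRegions {x : Fin 3 × G} (hx : x.2 ∈ S x.1) :
    𝒞.chainRegion S ρ x ∈ 𝒞.chainRegions S ρ := by
  classical
  exact Finset.mem_image_of_mem _ (by simpa using hx)

theorem exists_chainRegion (hX : 𝒞.SupportedOn {s | ∃ i, s ∈ 𝒞.nbhd (S i) (ρ i)} X) (u : Q)
    (hu : X u ≠ 0) : ∃ K ∈ 𝒞.chainRegions S ρ, 𝒞.site u ∈ K := by
  obtain ⟨i, g, hg, h⟩ := hX u hu
  exact ⟨_, mem_chainRegions (x := (i, g)) hg, (i, g), hg, .refl, h⟩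

theorem chainRegions_separated : ∀ K ∈ 𝒞.chainRegions S ρ, ∀ K' ∈ 𝒞.chainRegions S ρ,
    ∀ s ∈ K, ∀ s' ∈ K', cubeDist s s' ≤ 1 → K = K' := by
  classical
  intro K hK K' hK' s hs s' hs' h
  obtain ⟨x, hx, rfl⟩ := Finset.mem_image.1 hK
  obtain ⟨x', hx', rfl⟩ := Finset.mem_image.1 hK'
  obtain ⟨y', hy', hxy', hsy'⟩ := hs'
  rw [chainRegion_eq_of_chain (chain_of_near_chainRegion hy' hs hsy' h),
    chainRegion_eq_of_chain hxy']

/-- An operator can be localized if its pieces along chains can. -/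
theorem localizable_of_chainRegions (hX : 𝒞.SupportedOn {s | ∃ i, s ∈ 𝒞.nbhd (S i) (ρ i)} X)
    {W : Set (Site L)}
    (h : ∀ x : Fin 3 × G, x.2 ∈ S x.1 → 𝒞.Localizable W (𝒞.restrict (𝒞.chainRegion S ρ x) X)) :
    𝒞.Localizable W X := by
  classical
  rw [eq_sum_restrict (A := id) (exists_chainRegion hX) chainRegions_separated]
  refine Localizable.sum fun K hK => ?_
  obtain ⟨x, hx, rfl⟩ := Finset.mem_image.1 hK
  exact h x (by simpa using hx)

variable [NeZero L]

theorem mem_syndrome_of_mem_chainRegion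
    (hX : 𝒞.SupportedOn {s | ∃ i, s ∈ 𝒞.nbhd (S i) (ρ i)} X) {x : Fin 3 × G} (hx : x.2 ∈ S x.1)
    {g : G} (hg : g ∈ 𝒞.syndrome (𝒞.restrict (𝒞.chainRegion S ρ x) X)) :
    g ∈ 𝒞.syndrome X :=
  mem_syndrome_of_mem_syndrome_restrict (A := id) (exists_chainRegion hX)
    chainRegions_separated (mem_chainRegions hx) hg

/-- A defect is created by the piece of the operator along the chain to which it belongs. -/
theorem mem_syndrome_chainRegion_iff {x : Fin 3 × G}
    {g : G} (hg : g ∈ 𝒞.syndrome X) {i : Fin 3} (hgi : g ∈ S i) (hi : 1 ≤ ρ i) :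
    g ∈ 𝒞.syndrome (𝒞.restrict (𝒞.chainRegion S ρ x) X) ↔
      Relation.ReflTransGen (𝒞.Linked S ρ) x (i, g) := by
  constructor
  · intro h
    obtain ⟨u, hu, hd⟩ := exists_site_of_mem_syndrome h
    exact chain_of_near_chainRegion (y := (i, g)) hgi (supportedOn_restrict _ _ u hu)
      (hd.trans hi) (by simp [cubeDist_self])
  · intro h
    exact mem_syndrome_restrict_of_forall (A := fun _ : Unit => 𝒞.chainRegion S ρ x) (k := ())
      hg fun u _ hd => ⟨(i, g), hgi, h, hd.trans hi⟩

/-! ### Moving a sparse syndrome -/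

variable [DecidableEq G] {ℓ α : ℝ} {a t : ℕ}

/-- If an operator moves the sparse syndrome `S 0` to the sparse syndrome `S 2`, and is supported
near `S 0`, `S 1` and `S 2`, then the part near `S 1` can be removed. A cluster of `S 0` that moves
by more than `t` is neutral by the no-strings rule, and so is its image in `S 2`. -/
theorem localizable_of_three_sparse (htop : 𝒞.HasTopologicalOrder ℓ) (hns : 𝒞.NoStrings ℓ α)
    (ht : α * (a + 1) < t + 1) (hℓ : ℓ ≤ (L : ℝ) / 2)
    (hH : 2 * ((3 * t + 13 * a + 9 : ℕ) : ℝ) ≤ ℓ)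
    {S₀ S₁ S₂ : Finset G} (h₀ : 𝒞.Sparse a (2 * t + 10 * a + 9) S₀)
    (h₁ : 𝒞.Sparse a (2 * t + 10 * a + 9) S₁) (h₂ : 𝒞.Sparse a (2 * t + 10 * a + 9) S₂)
    (hX : 𝒞.SupportedOn (𝒞.nbhd S₀ (t + 2 * a + 1) ∪ 𝒞.nbhd S₁ (a + 1) ∪ 𝒞.nbhd S₂ (a + 1)) X)
    (hsyn : 𝒞.syndrome X = symmDiff S₀ S₂) :
    𝒞.Localizable (𝒞.nbhd S₀ (t + 2 * a + 1) ∪ 𝒞.nbhd S₂ (a + 1)) X := by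
  classical
  have hL : 4 * (3 * t + 13 * a + 9) ≤ L := by
    have : ((4 * (3 * t + 13 * a + 9) : ℕ) : ℝ) ≤ L := by push_cast at hH ⊢; linarith
    exact_mod_cast this
  set S : Fin 3 → Finset G := ![S₀, S₁, S₂] with hSdef
  set ρ : Fin 3 → ℕ := ![t + 2 * a + 1, a + 1, a + 1] with hρdef
  have hS : ∀ i, 𝒞.Sparse a (2 * t + 10 * a + 9) (S i) := by
    intro i
    fin_cases i
    exacts [h₀, h₁, h₂]
  have hρ0 : ρ 0 = t + 2 * a + 1 := rfl
  have hρ1 : ρ 1 = a + 1 := rfl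
  have hρ2 : ρ 2 = a + 1 := rfl
  have hρw : ∀ i, ρ i ≤ t + 2 * a + 1 := by
    intro i
    fin_cases i
    exacts [hρ0.le, hρ1.trans_le (by omega), hρ2.trans_le (by omega)]
  have hb : 2 * (ρ 0 + ρ 1 + ρ 2) + 2 * a + 3 ≤ 2 * t + 10 * a + 9 := by omega
  have hX' : 𝒞.SupportedOn {s | ∃ i, s ∈ 𝒞.nbhd (S i) (ρ i)} X := by
    refine hX.mono ?_
    rintro s ((h | h) | h)
    exacts [⟨0, h⟩, ⟨1, h⟩, ⟨2, h⟩]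
  refine localizable_of_chainRegions hX' fun x hx => ?_
  set Y := 𝒞.restrict (𝒞.chainRegion S ρ x) X with hY
  set C := S₀.filter fun g => Relation.ReflTransGen (𝒞.Linked S ρ) x (0, g) with hC
  set F := S₂.filter fun g => Relation.ReflTransGen (𝒞.Linked S ρ) x (2, g) with hF
  have hchain : ∀ y, Relation.ReflTransGen (𝒞.Linked S ρ) x y →
      y.2 ∈ S y.1 ∧ 𝒞.ChainEnds S ρ a x y := fun y h => chainEnds_of_reflTransGen hS hb hx h
  have hball : 𝒞.SupportedOn {s | cubeDist s (𝒞.cube x.2) ≤ 3 * t + 13 * a + 9} Y := by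
    refine (supportedOn_restrict _ _).mono ?_
    rintro s ⟨y, hy, hxy, hs⟩
    have h1 := (hchain y hxy).2.dist_le
    rw [defectDist_comm] at h1
    have h2 := cubeDist_triangle s (𝒞.cube y.2) (𝒞.cube x.2)
    have h3 := hρw y.1
    simp only [defectDist] at h1
    show cubeDist s (𝒞.cube x.2) ≤ _
    omega
  have hdC : ∀ g ∈ C, ∀ g' ∈ C, 𝒞.defectDist g g' ≤ a := by
    intro g hg g' hg'
    rw [hC, Finset.mem_filter] at hg hg'
    exact (chainEnds_of_reflTransGen hS hb (x := (0, g)) hg.1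
      ((chain_symm hg.2).trans hg'.2)).2.dist_le_of_eq rfl
  have hdF : ∀ g ∈ F, ∀ g' ∈ F, 𝒞.defectDist g g' ≤ a := by
    intro g hg g' hg'
    rw [hF, Finset.mem_filter] at hg hg'
    exact (chainEnds_of_reflTransGen hS hb (x := (2, g)) hg.1
      ((chain_symm hg.2).trans hg'.2)).2.dist_le_of_eq rfl
  have hCS : C ⊆ S₀ := Finset.filter_subset _ _
  have hFS : F ⊆ S₂ := Finset.filter_subset _ _
  have hsynY : 𝒞.syndrome Y = symmDiff C F := by
    ext g
    have hsub : g ∈ 𝒞.syndrome Y → g ∈ 𝒞.syndrome X := mem_syndrome_of_mem_chainRegion hX' hx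
    rw [hsyn] at hsub
    have e0 : g ∈ S₀ → g ∈ 𝒞.syndrome X →
        (g ∈ 𝒞.syndrome Y ↔ Relation.ReflTransGen (𝒞.Linked S ρ) x (0, g)) :=
      fun h0 hg => mem_syndrome_chainRegion_iff hg (i := 0) h0 (by omega)
    have e2 : g ∈ S₂ → g ∈ 𝒞.syndrome X →
        (g ∈ 𝒞.syndrome Y ↔ Relation.ReflTransGen (𝒞.Linked S ρ) x (2, g)) :=
      fun h0 hg => mem_syndrome_chainRegion_iff hg (i := 2) h0 (by omega)
    have e02 : g ∈ S₀ → g ∈ S₂ → (Relation.ReflTransGen (𝒞.Linked S ρ) x (0, g) ↔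
        Relation.ReflTransGen (𝒞.Linked S ρ) x (2, g)) := by
      intro hg0 hg2
      have hl : 𝒞.Linked S ρ (0, g) (2, g) := ⟨hg0, hg2, by simp [defectDist_self]⟩
      exact ⟨fun h => h.tail hl, fun h => h.tail hl.symm⟩
    rw [hsyn] at e0 e2
    simp only [Finset.mem_symmDiff, hC, hF, Finset.mem_filter] at hsub e0 e2 ⊢
    have key : ∀ p q c f y : Prop, (y → p ∧ ¬q ∨ q ∧ ¬p) → (p → p ∧ ¬q ∨ q ∧ ¬p → (y ↔ c)) →
        (q → p ∧ ¬q ∨ q ∧ ¬p → (y ↔ f)) → (p → q → (c ↔ f)) →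
        (y ↔ (p ∧ c) ∧ ¬(q ∧ f) ∨ (q ∧ f) ∧ ¬(p ∧ c)) := by
      clear * -
      intro p q c f y
      by_cases p <;> by_cases q <;> by_cases c <;> by_cases f <;> by_cases y <;> simp_all
    exact key _ _ _ _ _ hsub e0 e2 e02
  have hYcube : 𝒞.SupportedOnCube ℓ Y := supportedOnCube_of_ball hH hball
  by_cases hfar : ∀ g ∈ C, ∀ g' ∈ F, t < 𝒞.defectDist g g'
  · -- both clusters are neutral, and are created by local operators `U` and `V`
    have hdisj : Disjoint C F := by
      rw [Finset.disjoint_left]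
      intro g hg hg'
      have := hfar g hg g hg'
      rw [defectDist_self] at this
      omega
    have hsynY' : 𝒞.syndrome Y = C ∪ F := hsynY.trans hdisj.symmDiff_eq_sup
    obtain ⟨hnC, hnF⟩ := hns.isNeutral ht hYcube hsynY' hdC hdF hfar
    obtain ⟨U, hU, hsU⟩ := hnC.exists_nbhd htop (by omega) hdC
    obtain ⟨V, hV, hsV⟩ := hnF.exists_nbhd htop (by omega) hdF
    have hsum : 𝒞.Localizable (𝒞.nbhd S₀ (t + 2 * a + 1) ∪ 𝒞.nbhd S₂ (a + 1)) (U + V) := by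
      refine Localizable.add ?_ ?_
      · refine (hU.mono ?_).localizable
        exact fun s hs => Or.inl (nbhd_mono hCS (by omega) hs)
      · refine (hV.mono ?_).localizable
        exact fun s hs => Or.inr (nbhd_mono hFS le_rfl hs)
    refine hsum.of_add_mem ((htop _ (supportedOnCube_of_ball hH (x := 𝒞.cube x.2) ?_)).1 ?_)
    · refine hball.add (SupportedOn.add (hU.mono ?_) (hV.mono ?_))
      · rintro s ⟨g, hg, hs⟩
        have h1 := (hchain _ (Finset.mem_filter.1 hg).2).2.dist_le
        rw [defectDist_comm] at h1
        have h2 := cubeDist_triangle s (𝒞.cube g) (𝒞.cube x.2)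
        simp only [defectDist] at h1
        show cubeDist s (𝒞.cube x.2) ≤ _
        omega
      · rintro s ⟨g, hg, hs⟩
        have h1 := (hchain _ (Finset.mem_filter.1 hg).2).2.dist_le
        rw [defectDist_comm] at h1
        have h2 := cubeDist_triangle s (𝒞.cube g) (𝒞.cube x.2)
        simp only [defectDist] at h1
        show cubeDist s (𝒞.cube x.2) ≤ _
        omega
    · rw [syndrome_add, syndrome_add, hsU, hsV, hsynY, symmDiff_self]
      rfl
  · -- the clusters are close to each other: topological order moves the operator next to the
    -- defects it creates
    push Not at hfar
    obtain ⟨g₁, hg₁, g₂, hg₂, hd⟩ := hfar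
    by_cases hex : ∃ g ∈ 𝒞.syndrome Y, g ∈ C
    · obtain ⟨g, hg, hgC⟩ := hex
      have hdCF : ∀ g ∈ C, ∀ g' ∈ F, 𝒞.defectDist g g' ≤ t + 2 * a := by
        intro g hg g' hg'
        have h1 := hdC g hg g₁ hg₁
        have h2 := hdF g₂ hg₂ g' hg'
        have h3 := defectDist_triangle (𝒞 := 𝒞) g g₁ g'
        have h4 := defectDist_triangle (𝒞 := 𝒞) g₁ g₂ g'
        omega
      refine htop.localizable hYcube (k := t + 2 * a) (by omega) ?_ ?_
      · intro g hg g' hg'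
        rw [hsynY, Finset.mem_symmDiff] at hg hg'
        rcases hg with hg | hg <;> rcases hg' with hg' | hg'
        · exact (hdC _ hg.1 _ hg'.1).trans (by omega)
        · exact hdCF _ hg.1 _ hg'.1
        · rw [defectDist_comm]
          exact hdCF _ hg'.1 _ hg.1
        · exact (hdF _ hg.1 _ hg'.1).trans (by omega)
      · exact fun _ _ s hs => Or.inl ⟨g, hCS hgC, hs g hg⟩
    · push Not at hex
      have hsub : ∀ g ∈ 𝒞.syndrome Y, g ∈ F := by
        intro g hg
        have h1 := hex g hg
        rw [hsynY, Finset.mem_symmDiff] at hg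
        tauto
      refine htop.localizable hYcube (k := a) (by omega)
        (fun g hg g' hg' => hdF g (hsub g hg) g' (hsub g' hg')) ?_
      exact fun g hg s hs => Or.inr ⟨g, hFS (hsub g hg), hs g hg⟩

end LatticeCode

/-! ### Sparsity of syndromes with few defects -/

namespace LatticeCode

variable {L : ℕ} {Q G : Type*} [Fintype Q] {𝒞 : LatticeCode L Q G}

/-- A syndrome with at most `m` defects is sparse on one of the scales `q < m`: whenever it is not,
two clusters of diameter at most `A q` can be merged into one of diameter at most `A (q + 1)`, and
this is possible at most `m - 1` times. -/
theorem exists_sparse {A B : ℕ → ℕ} (hA : ∀ q, 2 * A q + B q ≤ A (q + 1)) {S : Finset G} {m : ℕ}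
    (hm : 0 < m) (hS : S.card ≤ m) : ∃ q < m, 𝒞.Sparse (A q) (B q) S := by
  classical
  by_contra! hne
  -- the fibres of `f` are the clusters after `q` mergers
  have key : ∀ q ≤ m, ∃ f : G → G, (S.image f).card + q ≤ S.card ∧
      ∀ g ∈ S, ∀ g' ∈ S, f g = f g' → 𝒞.defectDist g g' ≤ A q := by
    intro q
    induction q with
    | zero =>
      refine fun _ => ⟨id, by simp, ?_⟩
      rintro g - _ - rfl
      simp [defectDist_self]
    | succ q ih =>
      intro hq
      obtain ⟨f, hcard, hf⟩ := ih (by omega)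
      have hns := hne q (by omega)
      simp only [Sparse] at hns
      push Not at hns
      obtain ⟨x, hx, y, hy, h1, h2⟩ := hns
      have hxy : f y ≠ f x := fun h => absurd (hf x hx y hy h.symm) (by omega)
      refine ⟨fun g => if f g = f x then f y else f g, ?_, ?_⟩
      · have hsub : S.image (fun g => if f g = f x then f y else f g) ⊆ (S.image f).erase (f x) := by
          intro z hz
          obtain ⟨g, hg, rfl⟩ := Finset.mem_image.1 hz
          rw [Finset.mem_erase]
          split_ifs with h
          · exact ⟨hxy, Finset.mem_image_of_mem _ hy⟩
          · exact ⟨h, Finset.mem_image_of_mem _ hg⟩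
        have h3 := Finset.card_le_card hsub
        have h4 := Finset.mem_image_of_mem f hx
        rw [Finset.card_erase_of_mem h4] at h3
        have := Finset.card_pos.2 ⟨_, h4⟩
        omega
      · intro g hg g' hg' h
        have hAq := hA q
        beta_reduce at h
        split_ifs at h with h5 h6 h6
        · have := hf g hg g' hg' (h5.trans h6.symm)
          omega
        · have e1 := hf g hg x hx h5
          have e2 := hf y hy g' hg' h
          have e3 := defectDist_triangle (𝒞 := 𝒞) g x g'
          have e4 := defectDist_triangle (𝒞 := 𝒞) x y g'
          omega
        · have e1 := hf g hg y hy h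
          have e2 := hf x hx g' hg' h6.symm
          have e3 := defectDist_triangle (𝒞 := 𝒞) g y g'
          have e4 := defectDist_triangle (𝒞 := 𝒞) y x g'
          rw [defectDist_comm (𝒞 := 𝒞) y x] at e4
          omega
        · have := hf g hg g' hg' h
          omega
  obtain ⟨f, hcard, -⟩ := key m le_rfl
  have h0 : (S.image f).card = 0 := by omega
  rw [Finset.card_eq_zero, Finset.image_eq_empty] at h0
  exact hne 0 hm fun g hg => by simp [h0] at hg

/-! ### Removing the pieces of an operator away from its defects -/

/-- A chain either stays in the first two syndromes or has an initial part in them that is linked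
to a defect of the third one. -/
theorem chain_two_or_exists_link {S S' : Fin 3 → Finset G} {ρ ρ' : Fin 3 → ℕ}
    (hS : ∀ i, i ≠ 2 → S' i = S i ∧ ρ' i = ρ i) {x y : Fin 3 × G} (hx : x.1 ≠ 2)
    (h : Relation.ReflTransGen (𝒞.Linked S ρ) x y) :
    (y.1 ≠ 2 ∧ Relation.ReflTransGen (𝒞.Linked S' ρ') x y) ∨
      ∃ z z' : Fin 3 × G, z.1 ≠ 2 ∧ Relation.ReflTransGen (𝒞.Linked S' ρ') x z ∧ z'.1 = 2 ∧
        𝒞.Linked S ρ z z' := by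
  induction h with
  | refl => exact Or.inl ⟨hx, .refl⟩
  | @tail y z _ hyz ih =>
    rcases ih with ⟨hy, hxy⟩ | ih
    · by_cases hz : z.1 = 2
      · exact Or.inr ⟨y, z, hy, hxy, hz, hyz⟩
      · refine Or.inl ⟨hz, hxy.tail ⟨?_, ?_, ?_⟩⟩
        · rw [(hS _ hy).1]; exact hyz.1
        · rw [(hS _ hz).1]; exact hyz.2.1
        · rw [(hS _ hy).2, (hS _ hz).2]; exact hyz.2.2
    · exact Or.inr ih

variable [NeZero L] [Fintype G] [DecidableEq G] {ℓ α : ℝ} {a t : ℕ} {X : Pauli Q}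

/-- If all defects of `X` belong to `T`, then the pieces of `X` near two sparse syndromes that are
not linked to `T` can be removed, and the other ones are close to `T`. -/
theorem localizable_of_two_sparse (htop : 𝒞.HasTopologicalOrder ℓ)
    (hH : 2 * ((3 * t + 13 * a + 9 : ℕ) : ℝ) ≤ ℓ)
    {S₀ S₁ T : Finset G} (h₀ : 𝒞.Sparse a (2 * t + 10 * a + 9) S₀)
    (h₁ : 𝒞.Sparse a (2 * t + 10 * a + 9) S₁)
    (hX : 𝒞.SupportedOn (𝒞.nbhd S₀ (t + 2 * a + 1) ∪ 𝒞.nbhd S₁ (a + 1) ∪ 𝒞.nbhd T (a + 1)) X)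
    (hsyn : 𝒞.syndrome X ⊆ T) :
    𝒞.Localizable (𝒞.nbhd T (2 * t + 9 * a + 7)) X := by
  classical
  set S : Fin 3 → Finset G := ![S₀, S₁, T] with hSdef
  set S' : Fin 3 → Finset G := ![S₀, S₁, ∅] with hSdef'
  set ρ : Fin 3 → ℕ := ![t + 2 * a + 1, a + 1, a + 1] with hρdef
  set ρ' : Fin 3 → ℕ := ![t + 2 * a + 1, a + 1, 0] with hρdef'
  have hS' : ∀ i, 𝒞.Sparse a (2 * t + 10 * a + 9) (S' i) := by
    intro i
    fin_cases i
    exacts [h₀, h₁, fun g hg => absurd hg (Finset.notMem_empty g)]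
  have hSS : ∀ i, i ≠ 2 → S' i = S i ∧ ρ' i = ρ i := by
    intro i hi
    fin_cases i
    exacts [⟨rfl, rfl⟩, ⟨rfl, rfl⟩, absurd rfl hi]
  have hρ2 : ρ 2 = a + 1 := rfl
  have hρ0' : ρ' 0 = t + 2 * a + 1 := rfl
  have hρ1' : ρ' 1 = a + 1 := rfl
  have hρ2' : ρ' 2 = 0 := rfl
  have hρw : ∀ i, ρ i ≤ t + 2 * a + 1 := by
    intro i
    fin_cases i
    exacts [le_rfl, (show a + 1 ≤ _ by omega), (show a + 1 ≤ _ by omega)]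
  have hρsum : ∀ i j : Fin 3, i ≠ 2 → j ≠ 2 → i ≠ j → ρ i + ρ j = t + 3 * a + 2 := by
    intro i j hi hj hij
    fin_cases i <;> fin_cases j <;> simp [hρdef] at hi hj hij ⊢ <;> omega
  have hb : 2 * (ρ' 0 + ρ' 1 + ρ' 2) + 2 * a + 3 ≤ 2 * t + 10 * a + 9 := by omega
  have hX' : 𝒞.SupportedOn {s | ∃ i, s ∈ 𝒞.nbhd (S i) (ρ i)} X := by
    refine hX.mono ?_
    rintro s ((h | h) | h)
    exacts [⟨0, h⟩, ⟨1, h⟩, ⟨2, h⟩]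
  refine localizable_of_chainRegions hX' fun x hx => ?_
  by_cases hT : ∃ g, Relation.ReflTransGen (𝒞.Linked S ρ) x (2, g)
  · -- pieces linked to `T` are close to it
    obtain ⟨g, hxg⟩ := hT
    refine ((supportedOn_restrict _ _).mono ?_).localizable
    rintro s ⟨y, hy, hxy, hs⟩
    by_cases hy2 : y.1 = 2
    · rw [hy2] at hy hs
      exact ⟨y.2, hy, by omega⟩
    rcases chain_two_or_exists_link hSS hy2 ((chain_symm hxy).trans hxg) with
      ⟨h, _⟩ | ⟨z, z', hz, hyz, hz', hd1, hd2, hd3⟩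
    · exact absurd rfl h
    · rw [hz'] at hd2 hd3
      refine ⟨z'.2, hd2, ?_⟩
      have hyS : y.2 ∈ S' y.1 := by rw [(hSS _ hy2).1]; exact hy
      obtain ⟨hzS, hends⟩ := chainEnds_of_reflTransGen hS' hb hyS hyz
      have e1 := cubeDist_triangle s (𝒞.cube y.2) (𝒞.cube z'.2)
      have e2 := defectDist_triangle (𝒞 := 𝒞) y.2 z.2 z'.2
      have e3 : cubeDist (𝒞.cube y.2) (𝒞.cube z'.2) = 𝒞.defectDist y.2 z'.2 := rfl
      have e4 := hρw y.1
      have e5 := hρw z.1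
      by_cases hyz1 : z.1 = y.1
      · have := hends.dist_le_of_eq hyz1
        omega
      · have := hends.dist_le_of_two rfl hyS hzS hyz1
        have := hρsum _ _ hz hy2 hyz1
        omega
  · -- the other pieces are small and have an empty syndrome
    refine localizable_of_mem_stabilizers ((htop _ (supportedOnCube_of_ball hH
      (x := 𝒞.cube x.2) ?_)).1 ?_)
    · refine (supportedOn_restrict _ _).mono ?_
      rintro s ⟨y, hy, hxy, hs⟩
      have hx2 : x.1 ≠ 2 := by
        intro h
        refine hT ⟨x.2, ?_⟩
        rw [← h]
      rcases chain_two_or_exists_link hSS hx2 hxy with ⟨_, h⟩ | ⟨z, z', hz, hxz, hz', hl⟩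
      · have hxS : x.2 ∈ S' x.1 := by rw [(hSS _ hx2).1]; exact hx
        have h1 := (chainEnds_of_reflTransGen hS' hb hxS h).2.dist_le
        rw [defectDist_comm] at h1
        have h2 := cubeDist_triangle s (𝒞.cube y.2) (𝒞.cube x.2)
        have h3 := hρw y.1
        simp only [defectDist] at h1
        show cubeDist s (𝒞.cube x.2) ≤ _
        omega
      · exfalso
        have hzS : z.2 ∈ S' z.1 := by rw [(hSS _ hz).1]; exact hl.1
        have hxS : x.2 ∈ S' x.1 := by rw [(hSS _ hx2).1]; exact hx
        refine hT ⟨z'.2, ?_⟩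
        have hmono : ∀ p q, 𝒞.Linked S' ρ' p q → 𝒞.Linked S ρ p q := by
          rintro p q ⟨hp, hq, hd⟩
          have hp2 : p.1 ≠ 2 := fun h => by rw [h] at hp; simp [hSdef'] at hp
          have hq2 : q.1 ≠ 2 := fun h => by rw [h] at hq; simp [hSdef'] at hq
          rw [(hSS _ hp2).1] at hp
          rw [(hSS _ hq2).1] at hq
          rw [(hSS _ hp2).2, (hSS _ hq2).2] at hd
          exact ⟨hp, hq, hd⟩
        rw [← hz']
        exact (Relation.ReflTransGen.mono hmono _ _ hxz).tail hl
    · by_contra hne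
      obtain ⟨g, hg⟩ := Finset.nonempty_iff_ne_empty.2 hne
      have hgX := mem_syndrome_of_mem_chainRegion hX' hx hg
      exact hT ⟨g, (mem_syndrome_chainRegion_iff hgX (i := 2) (hsyn hgX) (by omega)).1 hg⟩

/-! ### One renormalization step along an error path -/

/-- Let `good` be a set of times at which the syndrome is sparse. If the errors between consecutive
good times are localized near the syndromes at their ends, then so is, on a larger scale, the error
between the two ends of the whole interval. -/
theorem localizable_of_sparse_times (htop : 𝒞.HasTopologicalOrder ℓ) (hns : 𝒞.NoStrings ℓ α)
    (ht : α * (a + 1) < t + 1) (hℓ : ℓ ≤ (L : ℝ) / 2)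
    (hH : 2 * ((3 * t + 13 * a + 9 : ℕ) : ℝ) ≤ ℓ) {Γ : ℕ → Pauli Q} {i j : ℕ} (hij : i ≤ j)
    {good : ℕ → Prop}
    (hgood : ∀ l, i < l → l < j → good l → 𝒞.Sparse a (2 * t + 10 * a + 9) (𝒞.syndrome (Γ l)))
    (hloc : ∀ i' j', i ≤ i' → i' ≤ j' → j' ≤ j → (∀ l, i' < l → l < j' → ¬ good l) →
      𝒞.Localizable (𝒞.nbhd (𝒞.syndrome (Γ i') ∪ 𝒞.syndrome (Γ j')) (a + 1)) (Γ i' + Γ j')) :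
    𝒞.Localizable (𝒞.nbhd (𝒞.syndrome (Γ i) ∪ 𝒞.syndrome (Γ j)) (2 * t + 9 * a + 7))
      (Γ i + Γ j) := by
  classical
  by_cases hex : ∃ l, i < l ∧ l < j ∧ good l
  swap
  · refine (hloc i j le_rfl hij le_rfl fun l h1 h2 h3 => hex ⟨l, h1, h2, h3⟩).mono ?_
    exact nbhd_mono le_rfl (by omega)
  -- the first good time
  obtain ⟨l₁, ⟨h1i, h1j, hg1⟩, hmin⟩ : ∃ l₁, (i < l₁ ∧ l₁ < j ∧ good l₁) ∧
      ∀ l, i < l → l < l₁ → ¬ good l := by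
    refine ⟨Nat.find hex, Nat.find_spec hex, fun l h1 h2 h3 => Nat.find_min hex h2 ⟨h1, ?_, h3⟩⟩
    exact h2.trans (Nat.find_spec hex).2.1
  -- the last good time before `k`
  have hprev : ∀ k, l₁ < k → ∃ l, l₁ ≤ l ∧ l < k ∧ good l ∧ ∀ l', l < l' → l' < k → ¬ good l' := by
    intro k hk
    obtain ⟨l, hl, hmax⟩ := Finset.exists_max_image
      ((Finset.range k).filter fun l => l₁ ≤ l ∧ good l) id
      ⟨l₁, by simp [hk, hg1]⟩
    simp only [Finset.mem_filter, Finset.mem_range, id] at hl hmax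
    refine ⟨l, hl.2.1, hl.1, hl.2.2, fun l' h1 h2 h3 => ?_⟩
    have := hmax l' ⟨h2, by omega, h3⟩
    omega
  have main : ∀ l, l₁ ≤ l → l < j → good l →
      𝒞.Localizable (𝒞.nbhd (𝒞.syndrome (Γ l₁)) (t + 2 * a + 1) ∪
        𝒞.nbhd (𝒞.syndrome (Γ l)) (a + 1)) (Γ l₁ + Γ l) := by
    intro l
    induction l using Nat.strong_induction_on with
    | _ l ih =>
      intro hl hlj hgl
      rcases hl.eq_or_lt with rfl | hlt
      · rw [Pauli.add_self]
        exact localizable_of_mem_stabilizers (zero_mem _)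
      · obtain ⟨k, hk1, hkl, hgk, hk⟩ := hprev l hlt
        obtain ⟨Y, hY, hYs⟩ := ih k hkl hk1 (by omega) hgk
        obtain ⟨E, hE, hEs⟩ := hloc k l (by omega) (by omega) (by omega) hk
        have hstab : (Γ l₁ + Γ l) + (Y + E) ∈ 𝒞.stabilizers := by
          rw [Pauli.add_eq_add_add_add Γ l₁ k l, add_add_add_comm]
          exact add_mem hYs hEs
        refine Localizable.of_add_mem (localizable_of_three_sparse htop hns ht hℓ hH
          (S₁ := 𝒞.syndrome (Γ k)) (hgood _ (by omega) (by omega) hg1)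
          (hgood _ (by omega) (by omega) hgk) (hgood _ (by omega) (by omega) hgl) ?_ ?_) hstab
        · refine (hY.mono ?_).add (hE.mono ?_)
          · exact Set.subset_union_left
          · rintro s ⟨g, hg, hs⟩
            rcases Finset.mem_union.1 hg with hg | hg
            · exact Or.inl (Or.inr ⟨g, hg, hs⟩)
            · exact Or.inr ⟨g, hg, hs⟩
        · rw [← syndrome_eq_of_add_mem hstab, syndrome_add]
  obtain ⟨l₂, h12, h2j, hg2, hl₂⟩ := hprev j h1j
  obtain ⟨Y, hY, hYs⟩ := main l₂ h12 h2j hg2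
  obtain ⟨E₁, hE₁, hEs₁⟩ := hloc i l₁ le_rfl h1i.le h1j.le hmin
  obtain ⟨E₂, hE₂, hEs₂⟩ := hloc l₂ j (by omega) h2j.le le_rfl hl₂
  have hstab : (Γ i + Γ j) + (E₁ + (Y + E₂)) ∈ 𝒞.stabilizers := by
    rw [Pauli.add_eq_add_add_add Γ i l₁ j, Pauli.add_eq_add_add_add Γ l₁ l₂ j, add_add_add_comm,
      add_add_add_comm (Γ l₁ + Γ l₂)]
    exact add_mem hEs₁ (add_mem hYs hEs₂)
  refine Localizable.of_add_mem (localizable_of_two_sparse htop hH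
    (hgood _ h1i h1j hg1) (hgood _ (by omega) h2j hg2) ?_ ?_) hstab
  · refine SupportedOn.add (hE₁.mono ?_) (SupportedOn.add (hY.mono Set.subset_union_left)
      (hE₂.mono ?_))
    · rintro s ⟨g, hg, hs⟩
      rcases Finset.mem_union.1 hg with hg | hg
      · exact Or.inr ⟨g, Finset.mem_union_left _ hg, hs⟩
      · exact Or.inl (Or.inl ⟨g, hg, by omega⟩)
    · rintro s ⟨g, hg, hs⟩
      rcases Finset.mem_union.1 hg with hg | hg
      · exact Or.inl (Or.inr ⟨g, hg, hs⟩)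
      · exact Or.inr ⟨g, Finset.mem_union_right _ hg, hs⟩
  · rw [← syndrome_eq_of_add_mem hstab, syndrome_add]
    exact symmDiff_le_sup

/-! ### Localization of errors with a small energy barrier -/

/-- The diameters of the clusters at the successive scales of the renormalization. -/
noncomputable def clusterScale (α : ℝ) : ℕ → ℕ
  | 0 => 0
  | p + 1 => 2 * ⌊α * (clusterScale α p + 1)⌋₊ + 12 * clusterScale α p + 9

theorem clusterScale_add_one_le (hα : 1 ≤ α) (p : ℕ) :
    ((clusterScale α p + 1 : ℕ) : ℝ) ≤ (20 * α) ^ p := by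
  induction p with
  | zero => simp [clusterScale]
  | succ p ih =>
    have h1 : (⌊α * (clusterScale α p + 1)⌋₊ : ℝ) ≤ α * (clusterScale α p + 1) :=
      Nat.floor_le (by positivity)
    rw [clusterScale, pow_succ]
    push_cast at ih ⊢
    have h2 : (0 : ℝ) ≤ clusterScale α p := by positivity
    nlinarith [mul_le_mul_of_nonneg_right ih (by positivity : (0 : ℝ) ≤ 20 * α),
      mul_le_mul_of_nonneg_right hα (by positivity : (0 : ℝ) ≤ (clusterScale α p : ℝ) + 1)]

/-- The balls needed at scale `p` have diameter at most `(80 * α) ^ (p + 1)`. -/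
theorem two_mul_radius_le (hα : 1 ≤ α) (p : ℕ) :
    2 * ((3 * ⌊α * (clusterScale α p + 1)⌋₊ + 13 * clusterScale α p + 9 : ℕ) : ℝ) ≤
      (80 * α) ^ (p + 1) := by
  have h1 : (⌊α * (clusterScale α p + 1)⌋₊ : ℝ) ≤ α * (clusterScale α p + 1) :=
    Nat.floor_le (by positivity)
  have h2 : (0 : ℝ) ≤ clusterScale α p := by positivity
  have ih := clusterScale_add_one_le hα p
  have h3 : (20 * α) ^ p ≤ (80 * α) ^ p := by gcongr; norm_num
  rw [pow_succ]
  push_cast at ih ⊢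
  nlinarith [mul_le_mul_of_nonneg_right (ih.trans h3) (by positivity : (0 : ℝ) ≤ 80 * α),
    mul_le_mul_of_nonneg_right hα (by positivity : (0 : ℝ) ≤ (clusterScale α p : ℝ) + 1)]

/-- The sparsity condition at scale `p`. -/
def SparseAt (𝒞 : LatticeCode L Q G) (α : ℝ) (p : ℕ) (S : Finset G) : Prop :=
  𝒞.Sparse (clusterScale α p)
    (2 * ⌊α * (clusterScale α p + 1)⌋₊ + 10 * clusterScale α p + 9) S

/-- A step of an error path is localized near the defects that it creates or removes. -/
theorem localizable_of_single_qubit (htop : 𝒞.HasTopologicalOrder ℓ) (hℓ : 0 ≤ ℓ)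
    {P P' : Pauli Q} (h : ∀ u v, P u ≠ P' u → P v ≠ P' v → u = v) :
    𝒞.Localizable (𝒞.nbhd (𝒞.syndrome P ∪ 𝒞.syndrome P') 1) (P + P') := by
  have hne : ∀ u, (P + P') u ≠ 0 → P u ≠ P' u := by
    intro u hu he
    refine hu ?_
    rw [Pi.add_apply, he, ← Pi.add_apply, Pauli.add_self]
    rfl
  rcases (𝒞.syndrome (P + P')).eq_empty_or_nonempty with h0 | ⟨g, hg⟩
  · refine localizable_of_mem_stabilizers ((htop _ ?_).1 h0)
    by_cases hex : ∃ u, (P + P') u ≠ 0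
    · obtain ⟨u, hu⟩ := hex
      refine ⟨𝒞.site u, fun v hv i => ?_⟩
      rw [h v u (hne v hv) (hne u hu)]
      simpa using hℓ
    · push Not at hex
      exact ⟨0, fun v hv => absurd (hex v) hv⟩
  · obtain ⟨u, hu, hd⟩ := exists_site_of_mem_syndrome hg
    refine SupportedOn.localizable fun v hv => ⟨g, ?_, ?_⟩
    · rw [syndrome_add] at hg
      exact symmDiff_le_sup (a := 𝒞.syndrome P) hg
    · rwa [h v u (hne v hv) (hne u hu)]

theorem localizable_of_forall_sparseAt (htop : 𝒞.HasTopologicalOrder ℓ) (hns : 𝒞.NoStrings ℓ α)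
    (hα : 1 ≤ α) (hℓ : ℓ ≤ (L : ℝ) / 2) {Γ : ℕ → Pauli Q} {T : ℕ}
    (hΓ : ∀ i < T, ∀ u v, Γ i u ≠ Γ (i + 1) u → Γ i v ≠ Γ (i + 1) v → u = v) (p : ℕ)
    (hp : (80 * α) ^ p ≤ ℓ) {i j : ℕ} (hij : i ≤ j) (hj : j ≤ T)
    (hsp : ∀ l, i < l → l < j → ∃ q < p, 𝒞.SparseAt α q (𝒞.syndrome (Γ l))) :
    𝒞.Localizable (𝒞.nbhd (𝒞.syndrome (Γ i) ∪ 𝒞.syndrome (Γ j)) (clusterScale α p + 1))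
      (Γ i + Γ j) := by
  induction p generalizing i j with
  | zero =>
    rcases hij.eq_or_lt with rfl | hlt
    · rw [Pauli.add_self]
      exact localizable_of_mem_stabilizers (zero_mem _)
    rcases (Nat.succ_le_of_lt hlt).eq_or_lt with rfl | hlt
    · refine localizable_of_single_qubit htop (le_trans ?_ hp) (hΓ i (by omega))
      positivity
    · obtain ⟨q, hq, -⟩ := hsp (i + 1) (by omega) (by omega)
      omega
  | succ p ih =>
    have hp' : (80 * α) ^ p ≤ ℓ := by
      refine le_trans (pow_le_pow_right₀ ?_ (Nat.le_succ p)) hp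
      linarith
    refine (localizable_of_sparse_times htop hns (Nat.lt_floor_add_one _) hℓ
      ((two_mul_radius_le hα p).trans hp) hij
      (good := fun l => ¬ ∃ q < p, 𝒞.SparseAt α q (𝒞.syndrome (Γ l))) ?_ ?_).mono
      (nbhd_mono le_rfl ?_)
    · intro l h1 h2 hgood
      obtain ⟨q, hq, hs⟩ := hsp l h1 h2
      rcases Nat.lt_succ_iff_lt_or_eq.1 hq with hlt | rfl
      · exact absurd ⟨q, hlt, hs⟩ hgood
      · exact hs
    · intro i' j' _ h2 h3 h4
      exact ih hp' h2 (h3.trans hj) fun l h5 h6 => not_not.1 (h4 l h5 h6)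
    · rw [clusterScale]
      omega

/-- An error with energy barrier `m > 0` is equivalent to one supported near its own defects. -/
theorem localizable_of_energyBarrier (htop : 𝒞.HasTopologicalOrder ℓ) (hns : 𝒞.NoStrings ℓ α)
    (hα : 1 ≤ α) (hℓ : ℓ ≤ (L : ℝ) / 2) {Γ : ℕ → Pauli Q} {T m : ℕ} {P : Pauli Q}
    (hΓ : IsErrorPath Γ T P) (hm : 0 < m) (hcard : ∀ i ≤ T, (𝒞.syndrome (Γ i)).card ≤ m)
    (hp : (80 * α) ^ m ≤ ℓ) :
    𝒞.Localizable (𝒞.nbhd (𝒞.syndrome P) (clusterScale α m + 1)) P := by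
  obtain ⟨h0, hT, hstep⟩ := hΓ
  have := localizable_of_forall_sparseAt htop hns hα hℓ hstep m hp (Nat.zero_le T) le_rfl
    fun l _ hl => exists_sparse (A := clusterScale α)
      (fun q => by rw [clusterScale]; omega) hm (hcard l hl.le)
  rwa [h0, hT, zero_add, syndrome_zero, Finset.empty_union] at this

end LatticeCode

/-! ### The renormalization group decoder -/

namespace LatticeCode

variable {L : ℕ} {Q G : Type*} [Fintype Q] {𝒞 : LatticeCode L Q G}

theorem Sparse.dist_le_trans {A B : ℕ} {S : Finset G} (hS : 𝒞.Sparse A B S) (hAB : 2 * A ≤ B) {g g' g'' : G} (hg : g ∈ S)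
    (hg'' : g'' ∈ S) (h : 𝒞.defectDist g g' ≤ A)
    (h' : 𝒞.defectDist g' g'' ≤ A) : 𝒞.defectDist g g'' ≤ A := by
  have := defectDist_triangle (𝒞 := 𝒞) g g' g''
  exact (hS g hg g'' hg'').resolve_right (by omega)

/-- The clusters of a sparse syndrome: the classes of the relation `d ≤ A`. -/
def clusters [DecidableEq G] (𝒞 : LatticeCode L Q G) (A : ℕ) (S : Finset G) :
    Finset (Finset G) :=
  S.image fun g => S.filter fun g' => 𝒞.defectDist g g' ≤ A

theorem mem_components [DecidableEq G] {r : ℕ} {S C : Finset G} : C ∈ 𝒞.components r S ↔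
    C ⊆ S ∧ C.Nonempty ∧ 𝒞.IsConnectedAt r C ∧
      ∀ C' ⊆ S, 𝒞.IsConnectedAt r C' → C ⊆ C' → C' = C := by
  simp [components]

theorem components_empty [DecidableEq G] (r : ℕ) : 𝒞.components r ∅ = ∅ := by
  refine Finset.eq_empty_of_forall_notMem fun C hC => ?_
  obtain ⟨h1, h2, -⟩ := mem_components.1 hC
  exact h2.ne_empty (Finset.subset_empty.1 h1)

section Clusters

variable [DecidableEq G] {A B : ℕ} {S : Finset G}

theorem exists_cluster {g : G} (hg : g ∈ S) : ∃ D ∈ 𝒞.clusters A S, g ∈ D :=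
  ⟨_, Finset.mem_image_of_mem _ hg, by simp [hg, defectDist_self]⟩

theorem subset_of_mem_clusters {D : Finset G} (hD : D ∈ 𝒞.clusters A S) : D ⊆ S := by
  obtain ⟨g, -, rfl⟩ := Finset.mem_image.1 hD
  exact Finset.filter_subset _ _

theorem nonempty_of_mem_clusters {D : Finset G} (hD : D ∈ 𝒞.clusters A S) : D.Nonempty := by
  obtain ⟨g, hg, rfl⟩ := Finset.mem_image.1 hD
  exact ⟨g, by simp [hg, defectDist_self]⟩

theorem Sparse.mem_cluster_iff (hS : 𝒞.Sparse A B S) (hAB : 2 * A ≤ B) {D : Finset G}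
    (hD : D ∈ 𝒞.clusters A S) {g : G} (hg : g ∈ D) {g' : G} :
    g' ∈ D ↔ g' ∈ S ∧ 𝒞.defectDist g g' ≤ A := by
  obtain ⟨x, hx, rfl⟩ := Finset.mem_image.1 hD
  rw [Finset.mem_filter] at hg ⊢
  have hgx := hg.2
  rw [defectDist_comm] at hgx
  exact ⟨fun h => ⟨h.1, hS.dist_le_trans hAB hg.1 h.1 hgx h.2⟩,
    fun h => ⟨h.1, hS.dist_le_trans hAB hx h.1 hg.2 h.2⟩⟩

theorem Sparse.clusters_disjoint (hS : 𝒞.Sparse A B S) (hAB : 2 * A ≤ B) {D D' : Finset G}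
    (hD : D ∈ 𝒞.clusters A S) (hD' : D' ∈ 𝒞.clusters A S) {g : G} (hg : g ∈ D) (hg' : g ∈ D') :
    D = D' := by
  ext x
  rw [hS.mem_cluster_iff hAB hD hg, hS.mem_cluster_iff hAB hD' hg']

theorem Sparse.dist_le_of_isConnectedAt (hS : 𝒞.Sparse A B S) (hAB : 2 * A ≤ B) {r : ℕ}
    (hr : r ≤ B) {C : Finset G} (hCS : C ⊆ S) (hC : 𝒞.IsConnectedAt r C) {g g' : G}
    (hg : g ∈ C) (hg' : g' ∈ C) : 𝒞.defectDist g g' ≤ A := by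
  by_contra hfar
  refine hC (C.filter fun x => 𝒞.defectDist g x ≤ A) (C.filter fun x => ¬ 𝒞.defectDist g x ≤ A)
    ⟨g, by simp [hg, defectDist_self]⟩ ⟨g', by simpa [hg'] using hfar⟩
    (Finset.disjoint_filter_filter_not _ _ _) (Finset.filter_union_filter_not_eq _ _) ?_
  intro x hx y hy
  rw [Finset.mem_filter] at hx hy
  by_contra hxy
  have := (hS x (hCS hx.1) y (hCS hy.1)).resolve_right (by omega)
  exact hy.2 (hS.dist_le_trans hAB (hCS hg) (hCS hy.1) hx.2 this)

theorem Sparse.exists_cluster_of_mem_components (hS : 𝒞.Sparse A B S) (hAB : 2 * A ≤ B) {r : ℕ}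
    (hr : r ≤ B) {S' : Finset G} (hS' : S' ⊆ S) {C : Finset G} (hC : C ∈ 𝒞.components r S') :
    C.Nonempty ∧ ∃ D ∈ 𝒞.clusters A S, C ⊆ D := by
  obtain ⟨hCS, hne, hconn, -⟩ := mem_components.1 hC
  obtain ⟨g, hg⟩ := id hne
  obtain ⟨D, hD, hgD⟩ := exists_cluster (𝒞 := 𝒞) (A := A) (hS' (hCS hg))
  refine ⟨hne, D, hD, fun g' hg' => (hS.mem_cluster_iff hAB hD hgD).2 ⟨hS' (hCS hg'), ?_⟩⟩
  exact hS.dist_le_of_isConnectedAt hAB hr (hCS.trans hS') hconn hg hg'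

/-- At a scale between the diameters of the clusters and their distances, the connected components
of a part of a sparse syndrome are its intersections with the clusters. -/
theorem Sparse.mem_components_iff (hS : 𝒞.Sparse A B S) (hAB : 2 * A ≤ B) {r : ℕ}
    (hrA : A ≤ r) (hr : r ≤ B) {S' : Finset G} (hS' : S' ⊆ S) {C : Finset G} :
    C ∈ 𝒞.components r S' ↔ C.Nonempty ∧ ∃ D ∈ 𝒞.clusters A S, C = S' ∩ D := by
  have hconn : ∀ D ∈ 𝒞.clusters A S, 𝒞.IsConnectedAt r (S' ∩ D) := by
    rintro D hD C₁ C₂ ⟨x, hx⟩ ⟨y, hy⟩ - hunion hfar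
    have hxD : x ∈ S' ∩ D := hunion ▸ Finset.mem_union_left _ hx
    have hyD : y ∈ S' ∩ D := hunion ▸ Finset.mem_union_right _ hy
    rw [Finset.mem_inter] at hxD hyD
    have h1 := ((hS.mem_cluster_iff hAB hD hxD.2).1 hyD.2).2
    have h2 := hfar x hx y hy
    omega
  constructor
  · intro hC
    obtain ⟨hne, D, hD, hCD⟩ := hS.exists_cluster_of_mem_components hAB hr hS' hC
    obtain ⟨hCS, -, -, hmax⟩ := mem_components.1 hC
    exact ⟨hne, D, hD,
      (hmax _ Finset.inter_subset_left (hconn D hD) (Finset.subset_inter hCS hCD)).symm⟩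
  · rintro ⟨hne, D, hD, rfl⟩
    refine mem_components.2 ⟨Finset.inter_subset_left, hne, hconn D hD, fun C' hC' hc hsub => ?_⟩
    refine Finset.Subset.antisymm (fun g' hg' => ?_) hsub
    obtain ⟨g, hg⟩ := hne
    have hgD := (Finset.mem_inter.1 hg).2
    exact Finset.mem_inter.2 ⟨hC' hg', (hS.mem_cluster_iff hAB hD hgD).2 ⟨hS' (hC' hg'),
      hS.dist_le_of_isConnectedAt hAB hr (hC'.trans hS') hc (hsub hg) hg'⟩⟩

end Clusters

/-! ### Operators that split over the clusters -/

section Split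

variable [Fintype G] {𝒦 : Finset (Finset G)} {R : ℕ} {X X' : Pauli Q}

/-- `X` is a product of operators, one for each cluster in `𝒦`, such that all defects of each
factor belong to its cluster, and each factor is supported within distance `R` of every defect of
its cluster. -/
def SplitsOver (𝒞 : LatticeCode L Q G) (𝒦 : Finset (Finset G)) (R : ℕ) (X : Pauli Q) : Prop :=
  ∃ Z : Finset G → Pauli Q, (∀ D ∈ 𝒦,
    𝒞.SupportedOn {s | ∀ g ∈ D, cubeDist s (𝒞.cube g) ≤ R} (Z D) ∧ 𝒞.syndrome (Z D) ⊆ D) ∧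
    X = ∑ D ∈ 𝒦, Z D

theorem splitsOver_zero : 𝒞.SplitsOver 𝒦 R 0 :=
  ⟨0, fun _ _ => ⟨supportedOn_zero _, by simp [syndrome_zero]⟩, by simp⟩

variable [DecidableEq G]

theorem SplitsOver.add (hX : 𝒞.SplitsOver 𝒦 R X) (hX' : 𝒞.SplitsOver 𝒦 R X') :
    𝒞.SplitsOver 𝒦 R (X + X') := by
  obtain ⟨Z, hZ, rfl⟩ := hX
  obtain ⟨Z', hZ', rfl⟩ := hX'
  refine ⟨Z + Z', fun D hD => ⟨(hZ D hD).1.add (hZ' D hD).1, ?_⟩, Finset.sum_add_distrib.symm⟩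
  rw [Pi.add_apply, syndrome_add]
  exact symmDiff_le_sup.trans (sup_le (hZ D hD).2 (hZ' D hD).2)

theorem SplitsOver.sum {ι : Type*} {s : Finset ι} {X : ι → Pauli Q}
    (h : ∀ k ∈ s, 𝒞.SplitsOver 𝒦 R (X k)) : 𝒞.SplitsOver 𝒦 R (∑ k ∈ s, X k) := by
  classical
  induction s using Finset.induction_on with
  | empty => exact splitsOver_zero
  | insert a s ha ih =>
    rw [Finset.sum_insert ha]
    exact (h a (Finset.mem_insert_self _ _)).add
      (ih fun k hk => h k (Finset.mem_insert_of_mem hk))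

theorem splitsOver_of_mem {D : Finset G} (hD : D ∈ 𝒦)
    (hX : 𝒞.SupportedOn {s | ∀ g ∈ D, cubeDist s (𝒞.cube g) ≤ R} X) (hs : 𝒞.syndrome X ⊆ D) :
    𝒞.SplitsOver 𝒦 R X := by
  refine ⟨fun D' => if D' = D then X else 0, fun D' _ => ?_, ?_⟩
  · dsimp only
    split_ifs with h
    · subst h
      exact ⟨hX, hs⟩
    · exact ⟨supportedOn_zero _, by simp [syndrome_zero]⟩
  · rw [Finset.sum_ite_eq' 𝒦 D, if_pos hD]

theorem SplitsOver.syndrome_subset (hX : 𝒞.SplitsOver 𝒦 R X) {g : G} (hg : g ∈ 𝒞.syndrome X) :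
    ∃ D ∈ 𝒦, g ∈ D := by
  obtain ⟨Z, hZ, rfl⟩ := hX
  by_contra! hne
  refine notMem_syndrome.2 ?_ hg
  rw [Pauli.comm_sum]
  exact Finset.sum_eq_zero fun D hD => notMem_syndrome.1 fun h => hne D hD ((hZ D hD).2 h)

/-- The syndrome of each factor is the part of the syndrome lying in its cluster. -/
theorem SplitsOver.exists_factors (hX : 𝒞.SplitsOver 𝒦 R X)
    (hdisj : ∀ D ∈ 𝒦, ∀ D' ∈ 𝒦, ∀ g ∈ D, g ∈ D' → D = D') :
    ∃ Z : Finset G → Pauli Q, (∀ D ∈ 𝒦,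
      𝒞.SupportedOn {s | ∀ g ∈ D, cubeDist s (𝒞.cube g) ≤ R} (Z D) ∧
        𝒞.syndrome (Z D) = 𝒞.syndrome X ∩ D) ∧ X = ∑ D ∈ 𝒦, Z D := by
  obtain ⟨Z, hZ, rfl⟩ := hX
  refine ⟨Z, fun D hD => ⟨(hZ D hD).1, ?_⟩, rfl⟩
  have key : ∀ g ∈ D, (g ∈ 𝒞.syndrome (Z D) ↔ g ∈ 𝒞.syndrome (∑ D ∈ 𝒦, Z D)) := by
    intro g hg
    rw [mem_syndrome, mem_syndrome, Pauli.comm_sum, Finset.sum_eq_single_of_mem D hD]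
    intro D' hD' hne
    exact notMem_syndrome.1 fun h => hne (hdisj _ hD' _ hD g ((hZ D' hD').2 h) hg)
  ext g
  rw [Finset.mem_inter]
  exact ⟨fun h => ⟨(key g ((hZ D hD).2 h)).1 h, (hZ D hD).2 h⟩, fun h => (key g h.2).2 h.1⟩

theorem SplitsOver.mem_stabilizers [NeZero L] {ℓ : ℝ} (htop : 𝒞.HasTopologicalOrder ℓ)
    (hX : 𝒞.SplitsOver 𝒦 R X) (hdisj : ∀ D ∈ 𝒦, ∀ D' ∈ 𝒦, ∀ g ∈ D, g ∈ D' → D = D')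
    (hne : ∀ D ∈ 𝒦, D.Nonempty) (hR : 2 * (R : ℝ) ≤ ℓ) (hs : 𝒞.syndrome X = ∅) :
    X ∈ 𝒞.stabilizers := by
  obtain ⟨Z, hZ, rfl⟩ := hX.exists_factors hdisj
  refine sum_mem fun D hD => ?_
  obtain ⟨g, hg⟩ := hne D hD
  refine (htop _ (supportedOnCube_of_ball hR (x := 𝒞.cube g)
    ((hZ D hD).1.mono fun s hs => hs g hg))).1 ?_
  rw [(hZ D hD).2, hs, Finset.empty_inter]

end Split

/-! ### The subroutine TestNeutral on small clusters -/

section TestNeutral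

variable [Fintype G] [NeZero L] {ℓ : ℝ} {T : Finset G → Pauli Q} {C : Finset G} {k : ℕ}

theorem IsTestNeutral.supportedOn (hT : 𝒞.IsTestNeutral ℓ T) (hC : C.Nonempty) (hk : 3 * k < L)
    (hd : ∀ g ∈ C, ∀ g' ∈ C, 𝒞.defectDist g g' ≤ k) :
    𝒞.SupportedOn {s | ∀ g ∈ C, cubeDist s (𝒞.cube g) ≤ k + 1} (T C) ∧
      𝒞.syndrome (T C) ⊆ C := by
  obtain ⟨B, hB, h1, h2, h3⟩ := hT C
  have hzero : T C = 0 → 𝒞.SupportedOn {s | ∀ g ∈ C, cubeDist s (𝒞.cube g) ≤ k + 1} (T C) ∧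
      𝒞.syndrome (T C) ⊆ C := fun h => by
    rw [h]
    exact ⟨supportedOn_zero _, by simp [syndrome_zero]⟩
  rcases lt_or_ge ℓ (B.size : ℝ) with hlt | hle
  · exact hzero (h1 hlt)
  by_cases hex : ∃ P, 𝒞.SupportedOn B.nbhd P ∧ 𝒞.syndrome P = C
  · obtain ⟨h4, h5⟩ := h2 hle hex
    exact ⟨h4.mono fun s hs g hg =>
      Box.dist_le_of_mem_nbhd (hB.side_le hC hk hd) hs (hB.1 g hg), h5.le⟩
  · exact hzero (h3 hle hex)

theorem IsTestNeutral.syndrome_eq (hT : 𝒞.IsTestNeutral ℓ T) (htop : 𝒞.HasTopologicalOrder ℓ)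
    (hC : C.Nonempty) (hk : 3 * k < L) (hkℓ : (k : ℝ) ≤ ℓ)
    (hd : ∀ g ∈ C, ∀ g' ∈ C, 𝒞.defectDist g g' ≤ k) (hn : 𝒞.IsNeutral ℓ C) :
    𝒞.syndrome (T C) = C := by
  obtain ⟨X, hX, rfl⟩ := hn
  obtain ⟨B, hB, -, h2, -⟩ := hT (𝒞.syndrome X)
  obtain ⟨B', hB', g, hg, hs⟩ := (htop X hX).2 hC.ne_empty
  have hside := hB.side_le hC hk hd
  -- the box of TestNeutral and the one of the topological order condition have to agree
  have hBB' : B.nbhd = B'.nbhd := hB.nbhd_unique hB' hC fun i => by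
    have := hside i
    omega
  have hsize : B.size ≤ k := Finset.sup_le fun i _ => hside i
  refine (h2 (le_trans (by exact_mod_cast hsize) hkℓ) ⟨X + g, hBB' ▸ hs, ?_⟩).2
  refine syndrome_eq_of_add_mem ?_
  rwa [add_right_comm, Pauli.add_self, zero_add]

end TestNeutral

/-! ### Success of the decoder -/

section Decoder

variable [Fintype G] [DecidableEq G] {ℓ : ℝ} {T : Finset G → Pauli Q} {S : Finset G}

/-- The state of the decoder after the levels `p < j`. -/
noncomputable def rgState (𝒞 : LatticeCode L Q G) (T : Finset G → Pauli Q) (S : Finset G)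
    (j : ℕ) : Pauli Q × Finset G :=
  (List.range j).foldl (𝒞.rgStep T) (0, S)

theorem rgState_succ (j : ℕ) :
    𝒞.rgState T S (j + 1) = 𝒞.rgStep T (𝒞.rgState T S j) j := by
  simp [rgState, List.range_succ]

theorem rgState_snd (j : ℕ) :
    (𝒞.rgState T S j).2 = symmDiff S (𝒞.syndrome (𝒞.rgState T S j).1) := by
  induction j with
  | zero => simp [rgState, syndrome_zero, ← Finset.bot_eq_empty]
  | succ j ih => rw [rgState_succ, rgStep, syndrome_add, ← symmDiff_assoc, ← ih]

/-- Once the syndrome is empty, the decoder does not do anything any more. -/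
theorem rgState_eq_of_le {j k : ℕ} (hjk : j ≤ k) (h : (𝒞.rgState T S j).2 = ∅) :
    𝒞.rgState T S k = 𝒞.rgState T S j := by
  induction k, hjk using Nat.le_induction with
  | base => rfl
  | succ k _ ih =>
    rw [rgState_succ, ih, rgStep, h, EC, components_empty, Finset.sum_empty, add_zero,
      syndrome_zero, symmDiff_self]
    exact Prod.ext rfl h.symm

theorem lt_numLevels {n : ℕ} (hℓ : ℓ ≤ (L : ℝ) / 2) (hn : (2 : ℝ) ^ n < ℓ) :
    n < numLevels L ℓ := by
  by_contra hle
  have hne : {n : ℕ | min ((L : ℝ) / 2) ℓ ≤ 2 ^ n}.Nonempty := by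
    obtain ⟨k, hk⟩ := pow_unbounded_of_one_lt ℓ (one_lt_two (α := ℝ))
    exact ⟨k, (min_le_right _ _).trans hk.le⟩
  have h1 : min ((L : ℝ) / 2) ℓ ≤ 2 ^ numLevels L ℓ := Nat.sInf_mem hne
  rw [min_eq_right hℓ] at h1
  have h2 : (2 : ℝ) ^ numLevels L ℓ ≤ 2 ^ n := pow_le_pow_right₀ one_le_two (not_lt.1 hle)
  linarith

theorem corrects_of_mem_stabilizers {P : Pauli Q} (h : P ∈ 𝒞.stabilizers) : 𝒞.Corrects ℓ T P := by
  have hstate : (𝒞.rgState T (𝒞.syndrome P) 0).2 = ∅ := syndrome_eq_empty_of_mem_stabilizers h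
  refine ⟨0, ?_, by simpa using h⟩
  change (if (𝒞.rgState T (𝒞.syndrome P) (numLevels L ℓ)).2 = ∅ then
    some (𝒞.rgState T (𝒞.syndrome P) (numLevels L ℓ)).1 else none) = _
  rw [rgState_eq_of_le (Nat.zero_le _) hstate, if_pos hstate]
  rfl

variable [NeZero L] {P P' : Pauli Q} {A B ρ : ℕ}

/-- An operator supported near a sparse syndrome splits over the clusters of the syndrome. -/
theorem Sparse.splitsOver (hS : 𝒞.Sparse A B (𝒞.syndrome P')) (hAB : 2 * A ≤ B)
    (hρ : 1 ≤ ρ) (hρB : 2 * ρ + 1 ≤ B) (hP' : 𝒞.SupportedOn (𝒞.nbhd (𝒞.syndrome P') ρ) P') :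
    𝒞.SplitsOver (𝒞.clusters A (𝒞.syndrome P')) (2 * A + 1 + ρ) P' := by
  set S := 𝒞.syndrome P' with hSdef
  have hcover : ∀ u, P' u ≠ 0 → ∃ D ∈ 𝒞.clusters A S, 𝒞.site u ∈ 𝒞.nbhd D ρ := by
    intro u hu
    obtain ⟨g, hg, h⟩ := hP' u hu
    obtain ⟨D, hD, hgD⟩ := exists_cluster (𝒞 := 𝒞) (A := A) hg
    exact ⟨D, hD, g, hgD, h⟩
  have hsep : ∀ D ∈ 𝒞.clusters A S, ∀ D' ∈ 𝒞.clusters A S, ∀ s ∈ 𝒞.nbhd D ρ,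
      ∀ s' ∈ 𝒞.nbhd D' ρ, cubeDist s s' ≤ 1 → D = D' := by
    rintro D hD D' hD' s ⟨g, hg, h⟩ s' ⟨g', hg', h'⟩ hss
    have hgS := subset_of_mem_clusters hD hg
    have hgS' := subset_of_mem_clusters hD' hg'
    have h1 := cubeDist_triangle (𝒞.cube g) s (𝒞.cube g')
    have h2 := cubeDist_triangle s s' (𝒞.cube g')
    rw [cubeDist_comm (𝒞.cube g) s] at h1
    have h3 : 𝒞.defectDist g g' ≤ A :=
      (hS g hgS g' hgS').resolve_right (by unfold defectDist; omega)
    exact hS.clusters_disjoint hAB hD hD' ((hS.mem_cluster_iff hAB hD hg).2 ⟨hgS', h3⟩) hg'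
  rw [eq_sum_restrict hcover hsep]
  refine SplitsOver.sum fun D hD => splitsOver_of_mem hD ?_ ?_
  · refine (supportedOn_restrict _ _).mono ?_
    rintro s ⟨g, hg, h⟩ g' hg'
    have h1 := cubeDist_triangle s (𝒞.cube g) (𝒞.cube g')
    have h2 := ((hS.mem_cluster_iff hAB hD hg).1 hg').2
    unfold defectDist at h2
    omega
  · intro g hg
    have hgS : g ∈ S := mem_syndrome_of_mem_syndrome_restrict hcover hsep hD hg
    obtain ⟨D', hD', hgD'⟩ := exists_cluster (𝒞 := 𝒞) (A := A) hgS
    obtain ⟨u, hu, hd⟩ := exists_site_of_mem_syndrome hg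
    rwa [hsep D hD D' hD' _ (supportedOn_restrict _ _ u hu) _ ⟨g, hgD', hd.trans hρ⟩
      (by simp [cubeDist_self])]

theorem corrects_of_sparse (htop : 𝒞.HasTopologicalOrder ℓ) (hT : 𝒞.IsTestNeutral ℓ T)
    (hℓ : ℓ ≤ (L : ℝ) / 2) (hPP' : P + P' ∈ 𝒞.stabilizers)
    (hS : 𝒞.Sparse A B (𝒞.syndrome P')) (hAB : 2 * A ≤ B) (hρ : 1 ≤ ρ) (hρB : 2 * ρ + 1 ≤ B)
    (hP' : 𝒞.SupportedOn (𝒞.nbhd (𝒞.syndrome P') ρ) P')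
    (hR : 2 * ((2 * A + 1 + ρ : ℕ) : ℝ) ≤ ℓ) : 𝒞.Corrects ℓ T P := by
  have hsplit := hS.splitsOver hAB hρ hρB hP'
  unfold Corrects
  rw [syndrome_eq_of_add_mem hPP']
  set S := 𝒞.syndrome P' with hSdef
  set 𝒦 := 𝒞.clusters A S with h𝒦
  have hdisj : ∀ D ∈ 𝒦, ∀ D' ∈ 𝒦, ∀ g ∈ D, g ∈ D' → D = D' :=
    fun D hD D' hD' g hg hg' => hS.clusters_disjoint hAB hD hD' hg hg'
  have hne : ∀ D ∈ 𝒦, D.Nonempty := fun D hD => nonempty_of_mem_clusters hD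
  have hdiam : ∀ D ∈ 𝒦, ∀ g ∈ D, ∀ g' ∈ D, 𝒞.defectDist g g' ≤ A :=
    fun D hD g hg g' hg' => ((hS.mem_cluster_iff hAB hD hg).1 hg').2
  have hAL : 3 * A < L := by
    have : ((4 * (2 * A + 1 + ρ) : ℕ) : ℝ) ≤ L := by push_cast at hR ⊢; linarith
    have : 4 * (2 * A + 1 + ρ) ≤ L := by exact_mod_cast this
    omega
  have hAℓ : (A : ℝ) ≤ ℓ := by
    push_cast at hR
    have : (0 : ℝ) ≤ A := by positivity
    have : (0 : ℝ) ≤ ρ := by positivity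
    linarith
  -- the level at which the decoder succeeds
  obtain ⟨n, hnA, hnB, hnℓ⟩ : ∃ n, A ≤ 2 ^ n ∧ 2 ^ n ≤ B ∧ 2 ^ n ≤ 2 * A + 2 := by
    refine ⟨Nat.log 2 A + 1, (Nat.lt_pow_succ_log_self (by norm_num) A).le, ?_⟩
    rw [pow_succ]
    rcases Nat.eq_zero_or_pos A with h0 | hpos
    · subst h0
      simp
      omega
    · have := Nat.pow_log_le_self 2 hpos.ne'
      omega
  have hlevels : n < numLevels L ℓ := by
    refine lt_numLevels hℓ (lt_of_lt_of_le ?_ hR)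
    have h1 : ((2 ^ n : ℕ) : ℝ) ≤ ((2 * A + 2 : ℕ) : ℝ) := by exact_mod_cast hnℓ
    push_cast at h1 ⊢
    have : (0 : ℝ) ≤ A := by positivity
    have : (1 : ℝ) ≤ ρ := by exact_mod_cast hρ
    linarith
  have hrange : ∀ X, 𝒞.SplitsOver 𝒦 (2 * A + 1 + ρ) X → symmDiff S (𝒞.syndrome X) ⊆ S := by
    intro X hX g hg
    rcases Finset.mem_symmDiff.1 hg with h | h
    · exact h.1
    · obtain ⟨D, hD, hgD⟩ := hX.syndrome_subset h.1
      exact subset_of_mem_clusters hD hgD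
  -- up to this level the corrections respect the clusters
  have hinv : ∀ j ≤ n + 1, 𝒞.SplitsOver 𝒦 (2 * A + 1 + ρ) (𝒞.rgState T S j).1 := by
    intro j
    induction j with
    | zero => exact fun _ => splitsOver_zero
    | succ j ih =>
      intro hj
      have ih := ih (by omega)
      rw [rgState_succ, rgStep]
      refine ih.add (SplitsOver.sum fun C hC => ?_)
      have hjB : 2 ^ j ≤ B := (Nat.pow_le_pow_right (by norm_num) (by omega)).trans hnB
      rw [rgState_snd] at hC
      obtain ⟨hCne, D, hD, hCD⟩ := hS.exists_cluster_of_mem_components hAB hjB (hrange _ ih) hC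
      obtain ⟨h1, h2⟩ := hT.supportedOn hCne hAL
        fun g hg g' hg' => hdiam D hD g (hCD hg) g' (hCD hg')
      refine splitsOver_of_mem hD (h1.mono fun s hs g hg => ?_) (h2.trans hCD)
      obtain ⟨g', hg'⟩ := hCne
      have h3 := hs g' hg'
      have h4 := cubeDist_triangle s (𝒞.cube g') (𝒞.cube g)
      have h5 := hdiam D hD g' (hCD hg') g hg
      unfold defectDist at h5
      omega
  have hstate : (𝒞.rgState T S (n + 1)).2 = ∅ := by
    rw [rgState_succ, rgStep]
    dsimp only
    have hsum := hsplit.add (hinv n (by omega))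
    have hsub := hrange _ (hinv n (by omega))
    have hsyn : 𝒞.syndrome (P' + (𝒞.rgState T S n).1) = (𝒞.rgState T S n).2 := by
      rw [syndrome_add, rgState_snd]
    rw [← rgState_snd] at hsub
    set S' := (𝒞.rgState T S n).2 with hS'
    have hcomp : ∀ C ∈ 𝒞.components (2 ^ n) S', 𝒞.syndrome (T C) = C := by
      intro C hC
      obtain ⟨hCne, D, hD, rfl⟩ := (hS.mem_components_iff hAB hnA hnB hsub).1 hC
      obtain ⟨Z, hZ, -⟩ := hsum.exists_factors hdisj
      obtain ⟨g, hg⟩ := id hCne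
      refine hT.syndrome_eq htop hCne hAL hAℓ (fun g hg g' hg' => hdiam D hD g
        (Finset.mem_inter.1 hg).2 g' (Finset.mem_inter.1 hg').2) ⟨Z D, ?_, ?_⟩
      · exact supportedOnCube_of_ball hR (x := 𝒞.cube g)
          ((hZ D hD).1.mono fun s hs => hs g (Finset.mem_inter.1 hg).2)
      · rw [(hZ D hD).2, hsyn]
    have hEC : 𝒞.syndrome (𝒞.EC T n S') = S' := by
      ext g
      rw [EC, mem_syndrome, Pauli.comm_sum]
      by_cases hg : g ∈ S'
      · obtain ⟨D, hD, hgD⟩ := exists_cluster (𝒞 := 𝒞) (A := A) (hsub hg)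
        have hmem : S' ∩ D ∈ 𝒞.components (2 ^ n) S' :=
          (hS.mem_components_iff hAB hnA hnB hsub).2
            ⟨⟨g, Finset.mem_inter.2 ⟨hg, hgD⟩⟩, D, hD, rfl⟩
        rw [Finset.sum_eq_single_of_mem _ hmem, ← mem_syndrome, hcomp _ hmem]
        · simp [hg, hgD]
        · intro C hC hCne
          refine notMem_syndrome.1 ?_
          rw [hcomp C hC]
          intro hgC
          obtain ⟨-, D', hD', rfl⟩ := (hS.mem_components_iff hAB hnA hnB hsub).1 hC
          rw [hdisj D' hD' D hD g (Finset.mem_inter.1 hgC).2 hgD] at hCne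
          exact hCne rfl
      · rw [Finset.sum_eq_zero]
        · simp [hg]
        · intro C hC
          refine notMem_syndrome.1 ?_
          rw [hcomp C hC]
          exact fun h => hg ((mem_components.1 hC).1 h)
    rw [hEC, symmDiff_self]
    rfl
  have hfinal : 𝒞.rgState T S (numLevels L ℓ) = 𝒞.rgState T S (n + 1) :=
    rgState_eq_of_le hlevels hstate
  refine ⟨(𝒞.rgState T S (n + 1)).1, ?_, ?_⟩
  · change (if (𝒞.rgState T S (numLevels L ℓ)).2 = ∅ then
      some (𝒞.rgState T S (numLevels L ℓ)).1 else none) = _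
    rw [hfinal, if_pos hstate]
  · have h1 : P' + (𝒞.rgState T S (n + 1)).1 ∈ 𝒞.stabilizers := by
      refine (hsplit.add (hinv _ le_rfl)).mem_stabilizers htop hdisj hne hR ?_
      rw [syndrome_add, ← hSdef, ← rgState_snd, hstate]
    have h2 : P + (𝒞.rgState T S (n + 1)).1 =
        (P + P') + (P' + (𝒞.rgState T S (n + 1)).1) := by
      rw [add_assoc, ← add_assoc P', Pauli.add_self, zero_add]
    rw [h2]
    exact add_mem hPP' h1

/-- The diameters of the successive scales at which the syndrome of an operator supported within
distance `ρ` of it may be sparse. -/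
def mergeScale (ρ : ℕ) : ℕ → ℕ
  | 0 => 0
  | q + 1 => 4 * mergeScale ρ q + (2 * ρ + 1)

theorem mergeScale_add_le {ρ : ℕ} (hρ : 1 ≤ ρ) (q : ℕ) : mergeScale ρ q + ρ ≤ 4 ^ q * ρ := by
  induction q with
  | zero => simp [mergeScale]
  | succ q ih =>
    rw [mergeScale, pow_succ, mul_right_comm]
    omega

end Decoder

/-! ### Errors with a small energy barrier -/

section EnergyBarrier

theorem exists_path_energyBarrier [Fintype G] (P : Pauli Q) :
    ∃ Γ t, IsErrorPath Γ t P ∧ ∀ i ≤ t, (𝒞.syndrome (Γ i)).card ≤ 𝒞.energyBarrier P := by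
  have hne : {k | ∃ Γ t, IsErrorPath Γ t P ∧ 𝒞.energyCost Γ t = k}.Nonempty := by
    obtain ⟨Γ, t, h⟩ := exists_isErrorPath P
    exact ⟨_, Γ, t, h, rfl⟩
  obtain ⟨Γ, t, h, hk⟩ := Nat.sInf_mem hne
  refine ⟨Γ, t, h, fun i hi => ?_⟩
  rw [energyBarrier, ← hk]
  exact Finset.le_sup (f := fun i => (𝒞.syndrome (Γ i)).card) (by simpa using Nat.lt_succ_of_le hi)

variable [Fintype G] [DecidableEq G] [NeZero L] {ℓ α : ℝ} {T : Finset G → Pauli Q} {P : Pauli Q}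

/-- An error that can be implemented without creating any defects is a stabilizer. -/
theorem mem_stabilizers_of_path (htop : 𝒞.HasTopologicalOrder ℓ) (hℓ : 0 ≤ ℓ)
    {Γ : ℕ → Pauli Q} {t : ℕ} (hΓ : IsErrorPath Γ t P)
    (h : ∀ i ≤ t, 𝒞.syndrome (Γ i) = ∅) : P ∈ 𝒞.stabilizers := by
  obtain ⟨h0, rfl, hstep⟩ := hΓ
  have key : ∀ i ≤ t, Γ i ∈ 𝒞.stabilizers := by
    intro i
    induction i with
    | zero => exact fun _ => h0 ▸ zero_mem _
    | succ i ih =>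
      intro hi
      obtain ⟨Y, hY, hs⟩ := localizable_of_single_qubit htop hℓ (hstep i (by omega))
      have hY0 : Y = 0 := by
        funext u
        by_contra hu
        obtain ⟨g, hg, -⟩ := hY u hu
        rw [h i (by omega), h (i + 1) hi] at hg
        simp at hg
      rw [hY0, add_zero] at hs
      have := add_mem (ih (by omega)) hs
      rwa [← add_assoc, Pauli.add_self, zero_add] at this
  exact key t le_rfl

theorem corrects_of_energyBarrier (htop : 𝒞.HasTopologicalOrder ℓ) (hns : 𝒞.NoStrings ℓ α)
    (hα : 1 ≤ α) (hℓ : ℓ ≤ (L : ℝ) / 2) (hT : 𝒞.IsTestNeutral ℓ T)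
    (hP : (80 * α) ^ 𝒞.energyBarrier P < ℓ) : 𝒞.Corrects ℓ T P := by
  obtain ⟨Γ, t, hΓ, hcard⟩ := exists_path_energyBarrier (𝒞 := 𝒞) P
  set m := 𝒞.energyBarrier P with hm
  rcases Nat.eq_zero_or_pos m with h0 | hpos
  · refine corrects_of_mem_stabilizers (mem_stabilizers_of_path htop ?_ hΓ fun i hi => ?_)
    · exact le_trans (by positivity) hP.le
    · have := hcard i hi
      rwa [h0, Nat.le_zero, Finset.card_eq_zero] at this
  obtain ⟨P', hP', hPP'⟩ := localizable_of_energyBarrier htop hns hα hℓ hΓ hpos hcard hP.le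
  set ρ := clusterScale α m + 1 with hρ
  have hPcard : (𝒞.syndrome P).card ≤ m := by
    have := hcard t le_rfl
    rwa [hΓ.2.1] at this
  rw [syndrome_eq_of_add_mem hPP'] at hP' hPcard
  obtain ⟨q, hq, hS⟩ := exists_sparse (𝒞 := 𝒞) (A := mergeScale ρ)
    (B := fun q => 2 * mergeScale ρ q + (2 * ρ + 1))
    (fun q => by rw [mergeScale]; omega) hpos hPcard
  refine corrects_of_sparse htop hT hℓ hPP' hS (by omega) (by omega) (by omega) hP' ?_
  have h1 := mergeScale_add_le (show 1 ≤ ρ by omega) q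
  have h2 : 2 * (2 * mergeScale ρ q + 1 + ρ) ≤ 4 ^ m * ρ := by
    calc 2 * (2 * mergeScale ρ q + 1 + ρ) ≤ 4 * (4 ^ q * ρ) := by omega
      _ = 4 ^ (q + 1) * ρ := by rw [pow_succ]; ring
      _ ≤ 4 ^ m * ρ := Nat.mul_le_mul_right _ (Nat.pow_le_pow_right (by norm_num) hq)
  have h3 : (ρ : ℝ) ≤ (20 * α) ^ m := clusterScale_add_one_le hα m
  calc 2 * ((2 * mergeScale ρ q + 1 + ρ : ℕ) : ℝ)
      = ((2 * (2 * mergeScale ρ q + 1 + ρ) : ℕ) : ℝ) := by push_cast; ring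
    _ ≤ ((4 ^ m * ρ : ℕ) : ℝ) := by exact_mod_cast h2
    _ = 4 ^ m * ρ := by push_cast; ring
    _ ≤ 4 ^ m * (20 * α) ^ m := by gcongr
    _ = (80 * α) ^ m := by rw [← mul_pow]; ring
    _ ≤ ℓ := hP.le

end EnergyBarrier

end LatticeCode

theorem lemma5 {L : ℕ} [NeZero L] {Q G : Type*} [Fintype Q] [Fintype G] [DecidableEq G]
    (𝒞 : LatticeCode L Q G) (Ltqo α : ℝ) (hL : Ltqo ≤ (L : ℝ) / 2) (hα : 1 ≤ α)
    (htop : 𝒞.HasTopologicalOrder Ltqo) (hns : 𝒞.NoStrings Ltqo α)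
    (T : Finset G → Pauli Q) (hT : 𝒞.IsTestNeutral Ltqo T) :
    (∀ P : Pauli Q, (80 * α) ^ 𝒞.energyBarrier P < Ltqo → 𝒞.Corrects Ltqo T P) ∧
    (∀ γ : ℝ, 0 < γ → (L : ℝ) ^ γ ≤ Ltqo →
      ∀ P : Pauli Q, (𝒞.energyBarrier P : ℝ) < γ / Real.log (80 * α) * Real.log L →
        𝒞.Corrects Ltqo T P) := by
  refine ⟨fun P hP => LatticeCode.corrects_of_energyBarrier htop hns hα hL hT hP,
    fun γ _ hLγ P hP => LatticeCode.corrects_of_energyBarrier htop hns hα hL hT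
      (lt_of_lt_of_le ?_ hLγ)⟩
  have hlog : 0 < Real.log (80 * α) := Real.log_pos (by linarith)
  have hLpos : (0 : ℝ) < L := by exact_mod_cast NeZero.pos L
  rw [← Real.log_lt_log_iff (by positivity) (Real.rpow_pos_of_pos hLpos γ), Real.log_pow,
    Real.log_rpow hLpos]
  rwa [div_mul_eq_mul_div, lt_div_iff₀ hlog] at hP
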